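/- Let $\Omega\subset\mathbb R^3$ be a bounded Lipschitz domain, i.e. a nonempty bounded connected open set whose boundary is locally, in suitable orthonormal coordinates, the graph of a Lipschitz function with $\Omega$ lying on one side of it. Let $1\le p<\infty$ and let $q\in(1,\infty]$ be the dual exponent, $1/p+1/q=1$ (so $q=\infty$ when $p=1$). Let $dV$ be the volume measure on $\Omega$ and $dA$ the surface measure on $\partial\Omega$; the norms of $L^p(\Omega)^3$ and $L^q(\Omega)^3$ are formed with the Euclidean norm $|\cdot|$ of $\mathbb R^3$. Let $\dot W^{1,p}(\Omega)$ be the space of all $\psi\in W^{1,p}(\Omega)$ with $\int_\Omega\psi\,dV=0$, normed by $\|\psi\|_{\dot W^{1,p}}=\|\nabla\psi\|_{L^p(\Omega)^3}$, and let $\dot\nabla:\dot W^{1,p}(\Omega)\to L^p(\Omega)^3$ be the gradient, so that its dual $\dot\nabla^*:L^q(\Omega)^3\to\dot W^{1,p}(\Omega)^*$ is given by $(\dot\nabla^*w)(\psi)=\int_\Omega w\cdot\nabla\psi\,dV$. A function $g\in L^p(\partial\Omega)$ is called the trace of $\psi$ if there are smooth functions $\varphi_n$ on $\overline\Omega$ with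 $\varphi_n\to\psi$ in $W^{1,p}(\Omega)$ and $\varphi_n|_{\partial\Omega}\to g$ in $L^p(\partial\Omega)$. Then every $\psi\in\dot W^{1,p}(\Omega)$ has exactly one trace $\gamma\psi$, and $\delta:\dot W^{1,p}(\Omega)\to L^p(\Omega)\times L^p(\partial\Omega)$, $\delta\psi=(\psi,\gamma\psi)$, is a bounded linear operator. Moreover, let $(\beta,\tau)\in (L^p(\Omega)\times L^p(\partial\Omega))^*\cong L^q(\Omega)\times L^q(\partial\Omega)$ and let $\delta^*(\beta,\tau)\in\dot W^{1,p}(\Omega)^*$ be the functional $\psi\mapsto\int_\Omega\beta\psi\,dV+\int_{\partial\Omega}\tau\,\gamma\psi\,dA$. Then there is $w^{\mathrm{opt}}\in L^q(\Omega)^3$ that satisfies the weak balance equation $\delta^*(\beta,\tau)=\dot\nabla^*(w^{\mathrm{opt}})$ and $$\omega_{(\beta,\tau)}:=\inf\{\|w\|_{L^q(\Omega)^3}\mid w\in L^q(\Omega)^3,\ \delta^*(\beta,\tau)=\dot\nabla^*(w)\}=\|w^{\mathrm{opt}}\|_{L^q(\Omega)^3},$$ and $$\omega_{(\beta,\tau)}=\|w^{\mathrm{opt}}\|_{L^q(\Omega)^3}=\|\delta^*(\beta,\tau)\|_{\dot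 W^{1,p}(\Omega)^*}=\sup\left\{\frac{\int_\Omega\beta\psi\,dV+\int_{\partial\Omega}\tau\,\gamma\psi\,dA}{\left[\int_\Omega|\nabla\psi|^p\,dV\right]^{1/p}}\ \Big|\ \psi\in\dot W^{1,p}(\Omega),\ \psi\neq0\right\}.$$ -/

import Mathlib

open MeasureTheory Set Filter Topology
open scoped ENNReal NNReal ContDiff

noncomputable section

namespace FluxOpt

/-- Physical space `ℝ³`, with its Euclidean norm. -/
abbrev E3 : Type := EuclideanSpace ℝ (Fin 3)

/-- `Ω ⊆ ℝ³` is a bounded Lipschitz domain: nonempty, connected, open, bounded, and near every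
boundary point it is, in suitable orthonormal coordinates `y = e x`, the set `y₂ > f (y₀, y₁)`
on one side of the graph of a Lipschitz function `f`. -/
structure IsLipschitzDomain (Ω : Set E3) : Prop where
  isOpen : IsOpen Ω
  isConnected : IsConnected Ω
  isBounded : Bornology.IsBounded Ω
  lipschitz_boundary : ∀ x₀ ∈ frontier Ω,
    ∃ (e : E3 ≃ₗᵢ[ℝ] E3) (f : EuclideanSpace ℝ (Fin 2) → ℝ) (K : ℝ≥0) (r : ℝ),
      LipschitzWith K f ∧ 0 < r ∧
        ∀ x ∈ Metric.ball x₀ r, x ∈ Ω ↔ f !₂[e x 0, e x 1] < e x 2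

/-- Volume measure on `Ω`. -/
abbrev volOn (Ω : Set E3) : Measure E3 := volume.restrict Ω

/-- Surface (area) measure on `∂Ω`: the two-dimensional Hausdorff measure, normalized so as to
agree with Lebesgue area on planes. -/
abbrev areaOn (Ω : Set E3) : Measure E3 := (μHE[2]).restrict (frontier Ω)

/-- `G` is the distributional gradient of `u` in `Ω`:
`∫_Ω u ∂ᵢφ = -∫_Ω Gᵢ φ` for all `φ ∈ C_c^∞(Ω)` and `i = 1, 2, 3`. -/
def IsWeakGradient (Ω : Set E3) (u : E3 → ℝ) (G : E3 → E3) : Prop :=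
  ∀ φ : E3 → ℝ, ContDiff ℝ ∞ φ → HasCompactSupport φ → tsupport φ ⊆ Ω → ∀ i : Fin 3,
    ∫ x in Ω, u x * fderiv ℝ φ x (EuclideanSpace.single i 1) = - ∫ x in Ω, G x i * φ x

variable (Ω : Set E3) (p q : ℝ≥0∞)

lemma integrable_mul_test [Fact (1 ≤ p)] {u : E3 → ℝ} (hu : MemLp u p (volOn Ω))
    {g : E3 → ℝ} (hg : Continuous g) (hc : HasCompactSupport g) :
    IntegrableOn (fun x => u x * g x) Ω :=
  (hu.locallyIntegrable Fact.out).integrable_smul_right_of_hasCompactSupport hg hc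

lemma test_fderiv {φ : E3 → ℝ} (hφ : ContDiff ℝ ∞ φ) (hc : HasCompactSupport φ) (v : E3) :
    Continuous (fun x => fderiv ℝ φ x v) ∧ HasCompactSupport (fun x => fderiv ℝ φ x v) :=
  ⟨(hφ.continuous_fderiv (by simp)).clm_apply continuous_const, hc.fderiv_apply ℝ v⟩

lemma memLp_coord {p : ℝ≥0∞} {μ : Measure E3} {G : E3 → E3} (hG : MemLp G p μ) (i : Fin 3) :
    MemLp (fun x => G x i) p μ :=
  (EuclideanSpace.proj (𝕜 := ℝ) i).comp_memLp' hG

/-- The space `Ẇ^{1,p}(Ω)` of all `ψ ∈ W^{1,p}(Ω)` with zero average over `Ω`. A Sobolev function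
is stored as the pair `(ψ, ∇ψ) ∈ L^p(Ω) × L^p(Ω)³`, in which the second entry is determined by the
first. (Integrability of `ψ` is automatic when `Ω` is bounded.) -/
def zeroMeanSobolev [Fact (1 ≤ p)] : Submodule ℝ (Lp ℝ p (volOn Ω) × Lp E3 p (volOn Ω)) where
  carrier := {ψ | IsWeakGradient Ω ψ.1 ψ.2 ∧ IntegrableOn ψ.1 Ω ∧ ∫ x in Ω, ψ.1 x = 0}
  zero_mem' := by
    have h1 : ((0 : Lp ℝ p (volOn Ω)) : E3 → ℝ) =ᵐ[volOn Ω] 0 := Lp.coeFn_zero _ _ _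
    have h2 : ((0 : Lp E3 p (volOn Ω)) : E3 → E3) =ᵐ[volOn Ω] 0 := Lp.coeFn_zero _ _ _
    refine ⟨fun φ _ _ _ i => ?_, ?_, ?_⟩
    · rw [integral_eq_zero_of_ae, integral_eq_zero_of_ae, neg_zero]
      · filter_upwards [h2] with x hx
        rw [Prod.snd_zero, hx]
        simp
      · filter_upwards [h1] with x hx
        rw [Prod.fst_zero, hx]
        simp
    · exact (integrable_congr h1).2 (integrable_zero _ _ _)
    · exact integral_eq_zero_of_ae h1
  add_mem' := by
    rintro ⟨u, G⟩ ⟨v, H⟩ ⟨hu, hui, hu0⟩ ⟨hv, hvi, hv0⟩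
    have h1 := Lp.coeFn_add u v
    have h2 := Lp.coeFn_add G H
    refine ⟨fun φ hφ hc hs i => ?_, (integrable_congr h1).2 (hui.add hvi), ?_⟩
    · obtain ⟨hd, hdc⟩ := test_fderiv hφ hc (EuclideanSpace.single i 1)
      have e1 : ∫ x in Ω, (u + v : Lp ℝ p (volOn Ω)) x *
          fderiv ℝ φ x (EuclideanSpace.single i 1) =
          ∫ x in Ω, (u x * fderiv ℝ φ x (EuclideanSpace.single i 1) +
            v x * fderiv ℝ φ x (EuclideanSpace.single i 1)) := by
        refine integral_congr_ae ?_
        filter_upwards [h1] with x hx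
        rw [hx]
        simp [add_mul]
      have e2 : ∫ x in Ω, (G + H : Lp E3 p (volOn Ω)) x i * φ x =
          ∫ x in Ω, (G x i * φ x + H x i * φ x) := by
        refine integral_congr_ae ?_
        filter_upwards [h2] with x hx
        rw [hx]
        simp [add_mul]
      have a1 := integrable_mul_test Ω p (Lp.memLp u) hd hdc
      have a2 := integrable_mul_test Ω p (Lp.memLp v) hd hdc
      have b1 := integrable_mul_test Ω p (memLp_coord (Lp.memLp G) i) hφ.continuous hc
      have b2 := integrable_mul_test Ω p (memLp_coord (Lp.memLp H) i) hφ.continuous hc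
      simp only [Prod.mk_add_mk]
      rw [e1, e2, integral_add a1 a2, integral_add b1 b2, hu φ hφ hc hs i, hv φ hφ hc hs i]
      ring
    · refine (integral_congr_ae h1).trans ?_
      simp only [Pi.add_apply]
      rw [integral_add hui hvi, hu0, hv0, add_zero]
  smul_mem' := by
    rintro c ⟨u, G⟩ ⟨hu, hui, hu0⟩
    have h1 := Lp.coeFn_smul c u
    have h2 := Lp.coeFn_smul c G
    refine ⟨fun φ hφ hc hs i => ?_, (integrable_congr h1).2 (hui.smul c), ?_⟩
    · have e1 : ∫ x in Ω, (c • u : Lp ℝ p (volOn Ω)) x *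
          fderiv ℝ φ x (EuclideanSpace.single i 1) =
          ∫ x in Ω, c * (u x * fderiv ℝ φ x (EuclideanSpace.single i 1)) := by
        refine integral_congr_ae ?_
        filter_upwards [h1] with x hx
        rw [hx]
        simp [mul_assoc]
      have e2 : ∫ x in Ω, (c • G : Lp E3 p (volOn Ω)) x i * φ x =
          ∫ x in Ω, c * (G x i * φ x) := by
        refine integral_congr_ae ?_
        filter_upwards [h2] with x hx
        rw [hx]
        simp [mul_assoc]
      simp only [Prod.smul_mk]
      rw [e1, e2, integral_const_mul, integral_const_mul, hu φ hφ hc hs i, mul_neg]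
    · refine (integral_congr_ae h1).trans ?_
      simp only [Pi.smul_apply, smul_eq_mul]
      rw [integral_const_mul, hu0, mul_zero]

/-- `Ẇ^{1,p}(Ω)` as a type of its own; its (semi)norm, below, is `‖∇ψ‖_{L^p(Ω)}`, not the norm
of `L^p × L^p`. -/
def WDot [Fact (1 ≤ p)] : Type := zeroMeanSobolev Ω p

instance [Fact (1 ≤ p)] : AddCommGroup (WDot Ω p) :=
  inferInstanceAs (AddCommGroup (zeroMeanSobolev Ω p))

instance [Fact (1 ≤ p)] : Module ℝ (WDot Ω p) :=
  inferInstanceAs (Module ℝ (zeroMeanSobolev Ω p))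

variable {Ω p q}

/-- `ψ` as an element of `L^p(Ω)`. -/
def WDot.toLp [Fact (1 ≤ p)] : WDot Ω p →ₗ[ℝ] Lp ℝ p (volOn Ω) :=
  LinearMap.fst ℝ _ _ ∘ₗ (zeroMeanSobolev Ω p).subtype

/-- The gradient `ψ ↦ ∇ψ ∈ L^p(Ω)³`, as a linear map. -/
def WDot.gradLM [Fact (1 ≤ p)] : WDot Ω p →ₗ[ℝ] Lp E3 p (volOn Ω) :=
  LinearMap.snd ℝ _ _ ∘ₗ (zeroMeanSobolev Ω p).subtype

/-- `‖ψ‖ = ‖∇ψ‖_{L^p(Ω)}`. (On a connected open set this is a norm.) -/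
instance [Fact (1 ≤ p)] : SeminormedAddCommGroup (WDot Ω p) :=
  SeminormedAddCommGroup.induced (WDot Ω p) (Lp E3 p (volOn Ω)) WDot.gradLM

instance [Fact (1 ≤ p)] : NormedSpace ℝ (WDot Ω p) :=
  NormedSpace.induced ℝ (WDot Ω p) (Lp E3 p (volOn Ω)) WDot.gradLM

lemma WDot.norm_def [Fact (1 ≤ p)] (ψ : WDot Ω p) : ‖ψ‖ = ‖WDot.gradLM ψ‖ := rfl

/-- `∇̇ : Ẇ^{1,p}(Ω) → L^p(Ω)³`, the bounded (norm-preserving) gradient operator. -/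
def gradDot [Fact (1 ≤ p)] : WDot Ω p →L[ℝ] Lp E3 p (volOn Ω) :=
  WDot.gradLM.mkContinuous 1 fun ψ => by rw [one_mul, WDot.norm_def]

/-- `g ∈ L^p(∂Ω)` is the boundary trace of `ψ`: there are smooth functions `φₙ` on `closure Ω`
with `φₙ → ψ` in `W^{1,p}(Ω)` whose boundary values `φₙ|∂Ω` converge to `g` in `L^p(∂Ω)`. -/
def IsTrace [Fact (1 ≤ p)] (ψ : WDot Ω p) (g : Lp ℝ p (areaOn Ω)) : Prop :=
  ∃ φ : ℕ → E3 → ℝ, (∀ n, ContDiff ℝ ∞ (φ n)) ∧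
    Tendsto (fun n => eLpNorm (fun x => φ n x - ψ.toLp x) p (volOn Ω)) atTop (𝓝 0) ∧
    Tendsto (fun n => eLpNorm (fun x => gradient (φ n) x - gradDot ψ x) p (volOn Ω))
      atTop (𝓝 0) ∧
    Tendsto (fun n => eLpNorm (fun x => φ n x - g x) p (areaOn Ω)) atTop (𝓝 0)

/-- `δ` is the map `ψ ↦ (ψ, γ ψ)`, where `γ ψ` is the boundary trace: the first component of `δ ψ`
is `ψ`, and the second is the one and only trace of `ψ`. -/
def IsDelta [Fact (1 ≤ p)]
    (δ : WDot Ω p →L[ℝ] Lp ℝ p (volOn Ω) × Lp ℝ p (areaOn Ω)) : Prop :=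
  ∀ ψ, (δ ψ).1 = ψ.toLp ∧ ∀ g, IsTrace ψ g ↔ g = (δ ψ).2

/-- `(β, τ) ∈ L^q(Ω) × L^q(∂Ω)` as a functional on `L^p(Ω) × L^p(∂Ω)`:
`(u, g) ↦ ∫_Ω β u dV + ∫_∂Ω τ g dA`. -/
def dataFunctional [Fact (1 ≤ p)] [Fact (1 ≤ q)] [ENNReal.HolderConjugate p q]
    (β : Lp ℝ q (volOn Ω)) (τ : Lp ℝ q (areaOn Ω)) :
    StrongDual ℝ (Lp ℝ p (volOn Ω) × Lp ℝ p (areaOn Ω)) :=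
  ((ContinuousLinearMap.mul ℝ ℝ).lpPairing (volOn Ω) q p β).coprod
    ((ContinuousLinearMap.mul ℝ ℝ).lpPairing (areaOn Ω) q p τ)

/-- `w ∈ L^q(Ω)³` as a functional on `L^p(Ω)³`: `v ↦ ∫_Ω w · v dV`. -/
def fluxFunctional [Fact (1 ≤ p)] [Fact (1 ≤ q)] [ENNReal.HolderConjugate p q]
    (w : Lp E3 q (volOn Ω)) : StrongDual ℝ (Lp E3 p (volOn Ω)) :=
  (innerSL ℝ).lpPairing (volOn Ω) q p w

/-- `∇̇* : L^q(Ω)³ → Ẇ^{1,p}(Ω)*`, the dual of `∇̇`: `(∇̇* w)(ψ) = ∫_Ω w · ∇ψ dV`. -/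
def gradDual [Fact (1 ≤ p)] [Fact (1 ≤ q)] [ENNReal.HolderConjugate p q]
    (w : Lp E3 q (volOn Ω)) : StrongDual ℝ (WDot Ω p) :=
  (fluxFunctional w).comp gradDot

/-- `δ* (β, τ) ∈ Ẇ^{1,p}(Ω)*`, the functional `ψ ↦ (β, τ)(δ ψ)`. -/
def deltaDual [Fact (1 ≤ p)] [Fact (1 ≤ q)] [ENNReal.HolderConjugate p q]
    (δ : WDot Ω p →L[ℝ] Lp ℝ p (volOn Ω) × Lp ℝ p (areaOn Ω))
    (β : Lp ℝ q (volOn Ω)) (τ : Lp ℝ q (areaOn Ω)) : StrongDual ℝ (WDot Ω p) :=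
  (dataFunctional β τ).comp δ

end FluxOpt

end

noncomputable section

namespace FluxOpt

/-! ### The dual of `L^p` with vector values: Radon–Nikodym densities and their norms. -/

section Riesz

variable {α : Type*} [MeasurableSpace α] {μ : Measure α} [IsFiniteMeasure μ]
  {E : Type*} [NormedAddCommGroup E] {p : ℝ≥0∞}

/-! Duality half. With the norm `‖∇ψ‖`, the gradient is norm-preserving, so any functional `L` on
`Ẇ^{1,p}(Ω)` is a functional of the same norm on the range of the gradient. Hahn–Banach extends it
to `L^p(Ω)³` without increasing the norm (`exists_extension_of_norm_map`), and since `p < ∞` and `Ω`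
has finite volume the Riesz theorem `exists_lpPairing_eq` turns the extension into a field `w` with
`‖w‖ ≤ ‖L‖`. Hölder gives `‖L‖ ≤ ‖w'‖` for every field representing `L`. Hence the infimum is
attained and equals `‖L‖` (`exists_optimal_flux`), and `‖L‖` is the supremum of the quotients
(`isLUB_ratio`).

Analytic half: the operator `δ` has to exist and be bounded for the gradient norm alone. Three facts
about a Lipschitz domain carry this: the Poincaré inequality (`IsLipschitzDomain.isPoincareSet`),
the trace inequality for smooth functions (`IsLipschitzDomain.exists_trace_bound`), and the density
of functions smooth up to the boundary (`IsLipschitzDomain.exists_smooth_approx`). All three rest on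
one geometric idea: near a boundary point there is a fixed direction that leads from the boundary
into `Ω`. Translating along it moves a boundary neighbourhood into an interior ball (Poincaré);
averaging along segments in that direction bounds boundary values by volume integrals (trace);
shifting a mollifier along it makes the convolution sample `Ω` only (density).

The trace of `ψ` is then the limit of the boundary values of smooth approximants; the trace
inequality, passed to the limit, gives uniqueness, and together with Poincaré it gives boundedness.
-/

lemma tendsto_measure_symmDiff_biUnion {f : ℕ → Set α} (hf : ∀ i, MeasurableSet (f i))
    (hd : Pairwise (Function.onFun Disjoint f)) :
    Tendsto (fun s : Finset ℕ => μ (symmDiff (⋃ i ∈ s, f i) (⋃ i, f i))) atTop (𝓝 0) := by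
  have h1 : Tendsto (fun s : Finset ℕ => μ (⋃ i, f i) - ∑ i ∈ s, μ (f i)) atTop
      (𝓝 (μ (⋃ i, f i) - μ (⋃ i, f i))) := by
    refine ENNReal.Tendsto.sub tendsto_const_nhds ?_ (Or.inl (measure_ne_top _ _))
    rw [measure_iUnion hd hf]
    exact ENNReal.summable.hasSum
  rw [tsub_self] at h1
  refine h1.congr fun s => ?_
  have hsub : (⋃ i ∈ s, f i) ⊆ ⋃ i, f i := iUnion₂_subset fun i _ => subset_iUnion f i
  rw [symmDiff_of_le hsub, measure_sdiff hsub
    (Finset.measurableSet_biUnion _ fun i _ => hf i).nullMeasurableSet (measure_ne_top _ _),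
    measure_biUnion_finset (fun i _ j _ hij => hd hij) fun i _ => hf i]

lemma indicatorConstLp_biUnion {f : ℕ → Set α} (hf : ∀ i, MeasurableSet (f i))
    (hd : Pairwise (Function.onFun Disjoint f)) (c : E) (s : Finset ℕ) :
    indicatorConstLp p (Finset.measurableSet_biUnion s fun i _ => hf i) (measure_ne_top μ _) c =
      ∑ i ∈ s, indicatorConstLp p (hf i) (measure_ne_top μ _) c := by
  classical
  induction s using Finset.induction_on with
  | empty => simp
  | insert a s ha ih =>
    rw [Finset.sum_insert ha, ← ih]
    have hdis : Disjoint (f a) (⋃ i ∈ s, f i) := by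
      rw [disjoint_iUnion₂_right]
      intro i hi
      exact hd (by rintro rfl; exact ha hi)
    rw [← indicatorConstLp_disjoint_union (hf a) (Finset.measurableSet_biUnion s fun i _ => hf i)
      (measure_ne_top μ _) (measure_ne_top μ _) hdis]
    congr 1
    simp

variable [NormedSpace ℝ E] [Fact (1 ≤ p)]

open Classical in
/-- The signed measure `A ↦ ℓ (1_A c)` attached to a functional on `L^p`. -/
def dualSignedMeasure (hp : p ≠ ⊤) (ℓ : StrongDual ℝ (Lp E p μ)) (c : E) : SignedMeasure α where
  measureOf' A := if hA : MeasurableSet A then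
    ℓ (indicatorConstLp p hA (measure_ne_top μ _) c) else 0
  empty' := by simp
  not_measurable' A hA := dif_neg hA
  -- Countable additivity needs `p ≠ ⊤`: only then do indicators of sets converging in measure
  -- converge in `L^p`.
  m_iUnion' f hf hd := by
    have h1 : Tendsto (fun s : Finset ℕ => indicatorConstLp p
        (Finset.measurableSet_biUnion s fun i _ => hf i) (measure_ne_top μ _) c) atTop
        (𝓝 (indicatorConstLp p (MeasurableSet.iUnion hf) (measure_ne_top μ _) c)) :=
      tendsto_indicatorConstLp_set hp (tendsto_measure_symmDiff_biUnion hf hd)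
    have h2 := (ℓ.continuous.tendsto _).comp h1
    rw [dif_pos (MeasurableSet.iUnion hf)]
    refine h2.congr fun s => ?_
    simp only [Function.comp_apply]
    rw [indicatorConstLp_biUnion hf hd, map_sum]
    exact Finset.sum_congr rfl fun i _ => by rw [dif_pos (hf i)]

lemma dualSignedMeasure_apply (hp : p ≠ ⊤) (ℓ : StrongDual ℝ (Lp E p μ)) (c : E) {A : Set α}
    (hA : MeasurableSet A) : dualSignedMeasure hp ℓ c A =
      ℓ (indicatorConstLp p hA (measure_ne_top μ _) c) := by
  exact dif_pos hA

/-- Radon–Nikodym: the indicator of a null set is zero in `L^p`, so the signed measure is absolutely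
continuous. -/
lemma exists_density (hp : p ≠ ⊤) (ℓ : StrongDual ℝ (Lp E p μ)) (c : E) :
    ∃ w : α → ℝ, Integrable w μ ∧ ∀ A (hA : MeasurableSet A),
      ℓ (indicatorConstLp p hA (measure_ne_top μ _) c) = ∫ x in A, w x ∂μ := by
  set s := dualSignedMeasure hp ℓ c
  have hs : s ≪ᵥ μ.toENNRealVectorMeasure := by
    refine VectorMeasure.AbsolutelyContinuous.mk fun A hA h0 => ?_
    rw [Measure.toENNRealVectorMeasure_apply_measurable hA] at h0
    rw [dualSignedMeasure_apply hp ℓ c hA]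
    have : indicatorConstLp p hA (measure_ne_top μ _) c = 0 := by
      rw [← norm_eq_zero, norm_indicatorConstLp (by have := (Fact.out : 1 ≤ p); positivity) hp,
        measureReal_def, h0]
      have : p.toReal ≠ 0 := ENNReal.toReal_ne_zero.2
        ⟨(lt_of_lt_of_le zero_lt_one Fact.out).ne', hp⟩
      simp [this]
    rw [this, map_zero]
  refine ⟨s.rnDeriv μ, s.integrable_rnDeriv μ, fun A hA => ?_⟩
  rw [← withDensityᵥ_apply (s.integrable_rnDeriv μ) hA, s.withDensityᵥ_rnDeriv_eq μ hs,
    dualSignedMeasure_apply hp ℓ c hA]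

end Riesz

section RieszVector

variable {α : Type*} [MeasurableSpace α] {μ : Measure α} [IsFiniteMeasure μ]
  {ι : Type*} [Fintype ι] {p q : ℝ≥0∞} [Fact (1 ≤ p)]

/-- Scalar densities are taken along the coordinate vectors and reassembled. A strongly measurable
version is kept so that level sets of its norm are measurable. -/
lemma exists_vector_density (hp : p ≠ ⊤) (ℓ : StrongDual ℝ (Lp (EuclideanSpace ℝ ι) p μ)) :
    ∃ w : α → EuclideanSpace ℝ ι, StronglyMeasurable w ∧ Integrable w μ ∧
      ∀ A (hA : MeasurableSet A) (c : EuclideanSpace ℝ ι),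
      ℓ (indicatorConstLp p hA (measure_ne_top μ _) c) = ∫ x in A, inner ℝ (w x) c ∂μ := by
  classical
  choose w hw hwA using fun i : ι => exists_density hp ℓ (EuclideanSpace.single i (1 : ℝ))
  have hint : Integrable (fun x => (WithLp.toLp 2 fun i => w i x : EuclideanSpace ℝ ι)) μ := by
    have : (fun x => (WithLp.toLp 2 fun i => w i x : EuclideanSpace ℝ ι)) =
        fun x => ∑ i, w i x • EuclideanSpace.single i (1 : ℝ) := by
      ext x j
      simp [Finset.sum_apply, Pi.single_apply]
    rw [this]
    exact integrable_finsetSum _ fun i _ => (hw i).smul_const _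
  obtain ⟨W, hW, hWe⟩ := hint.1
  refine ⟨W, hW, hint.congr hWe, fun A hA c => ?_⟩
  have e1 : indicatorConstLp p hA (measure_ne_top μ _) c =
      ∑ i, c i • indicatorConstLp p hA (measure_ne_top μ _)
        (EuclideanSpace.single i (1 : ℝ)) := by
    have hc : c = ∑ i, c i • EuclideanSpace.single i (1 : ℝ) := by
      ext j
      simp [Finset.sum_apply, Pi.single_apply]
    ext1
    refine indicatorConstLp_coeFn.trans ?_
    have h1 := Lp.coeFn_finsetSum (Finset.univ : Finset ι) fun i => c i •
      indicatorConstLp p hA (measure_ne_top μ _) (EuclideanSpace.single i (1 : ℝ))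
    have h2 : ∀ᵐ x ∂μ, ∀ i, (c i • indicatorConstLp p hA (measure_ne_top μ _)
        (EuclideanSpace.single i (1 : ℝ)) : Lp (EuclideanSpace ℝ ι) p μ) x =
        c i • A.indicator (fun _ => EuclideanSpace.single i (1 : ℝ)) x := by
      rw [ae_all_iff]
      intro i
      filter_upwards [Lp.coeFn_smul (c i) (indicatorConstLp p hA (measure_ne_top μ _)
        (EuclideanSpace.single i (1 : ℝ))), indicatorConstLp_coeFn (p := p) (hs := hA)
        (hμs := measure_ne_top μ _)
        (c := (EuclideanSpace.single i (1 : ℝ) : EuclideanSpace ℝ ι))] with x h3 h4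
      rw [h3, Pi.smul_apply, h4]
    filter_upwards [h1, h2] with x h3 h4
    rw [h3, Finset.sum_apply, Finset.sum_congr rfl fun i _ => h4 i]
    by_cases hx : x ∈ A
    · simpa [hx] using hc
    · simp [hx]
  rw [e1, map_sum]
  simp only [map_smul, smul_eq_mul, hwA _ A hA]
  simp only [← integral_const_mul]
  rw [← integral_finsetSum _ fun i _ => ((hw i).integrableOn).const_mul _]
  refine integral_congr_ae ?_
  filter_upwards [ae_restrict_of_ae hWe] with x hx
  rw [← hx]
  simp [PiLp.inner_apply]

end RieszVector

/-- Dominated convergence for the `p`-th powers; the constant dominating function is integrable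
because `μ` is finite. -/
lemma tendsto_eLpNorm_of_bounded {α E : Type*} [MeasurableSpace α] {μ : Measure α}
    [IsFiniteMeasure μ] [NormedAddCommGroup E] {p : ℝ≥0∞} (hp0 : p ≠ 0) (hp : p ≠ ⊤)
    {f : ℕ → α → E} {g : α → E} (hf : ∀ n, AEStronglyMeasurable (f n) μ)
    (hg : AEStronglyMeasurable g μ) {C : ℝ} (hC : ∀ n x, ‖f n x - g x‖ ≤ C)
    (h : ∀ᵐ x ∂μ, Tendsto (fun n => f n x) atTop (𝓝 (g x))) :
    Tendsto (fun n => eLpNorm (f n - g) p μ) atTop (𝓝 0) := by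
  have hpos : 0 < p.toReal := ENNReal.toReal_pos hp0 hp
  simp only [eLpNorm_eq_lintegral_rpow_enorm_toReal hp0 hp]
  have h0 : Tendsto (fun n => ∫⁻ x, ‖(f n - g) x‖ₑ ^ p.toReal ∂μ) atTop
      (𝓝 (∫⁻ _, 0 ∂μ)) := by
    refine tendsto_lintegral_of_dominated_convergence' (fun _ => ENNReal.ofReal C ^ p.toReal)
      (fun n => (((hf n).sub hg).enorm).pow_const _) (fun n => ae_of_all _ fun x => ?_) ?_ ?_
    · refine ENNReal.rpow_le_rpow ?_ hpos.le
      rw [← ofReal_norm]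
      exact ENNReal.ofReal_le_ofReal (hC n x)
    · rw [lintegral_const]
      exact ENNReal.mul_ne_top (ENNReal.rpow_ne_top_of_nonneg hpos.le ENNReal.ofReal_ne_top)
        (measure_ne_top _ _)
    · filter_upwards [h] with x hx
      have h1 : Tendsto (fun n => ‖(f n - g) x‖ₑ) atTop (𝓝 0) := by
        have := (hx.sub_const (g x)).enorm
        simpa using this
      have := h1.ennrpow_const p.toReal
      rwa [ENNReal.zero_rpow_of_pos hpos] at this
  have := h0.ennrpow_const (1 / p.toReal)
  rwa [lintegral_zero, ENNReal.zero_rpow_of_pos (by positivity)] at this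

section Riesz

variable {α : Type*} [MeasurableSpace α] {μ : Measure α} [IsFiniteMeasure μ]
  {E : Type*} [NormedAddCommGroup E] [InnerProductSpace ℝ E] {p : ℝ≥0∞} [Fact (1 ≤ p)]
  {ℓ : StrongDual ℝ (Lp E p μ)} {W : α → E}

omit [IsFiniteMeasure μ] in
lemma integrable_inner_of_bound (hW : Integrable W μ) {v : α → E}
    (hv : AEStronglyMeasurable v μ) {C : ℝ} (hC : ∀ x, ‖v x‖ ≤ C) :
    Integrable (fun x => inner ℝ (W x) (v x)) μ := by
  refine (hW.norm.mul_const C).mono' (hW.1.inner hv) (ae_of_all _ fun x => ?_)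
  exact (norm_inner_le_norm _ _).trans (mul_le_mul_of_nonneg_left (hC x) (norm_nonneg _))

lemma apply_simpleFunc (hW : Integrable W μ)
    (h : ∀ A (hA : MeasurableSet A) (c : E),
      ℓ (indicatorConstLp p hA (measure_ne_top μ _) c) = ∫ x in A, inner ℝ (W x) c ∂μ)
    (f : SimpleFunc α E) :
    ℓ ((f.memLp_of_isFiniteMeasure p μ).toLp f) = ∫ x, inner ℝ (W x) (f x) ∂μ := by
  classical
  induction f using SimpleFunc.induction with
  | const c hs =>
    rename_i s
    have : ((SimpleFunc.piecewise s hs (SimpleFunc.const α c) (SimpleFunc.const α 0)) : α → E) =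
        s.indicator fun _ => c := by
      ext x; simp [Set.indicator, Set.piecewise]
    have h2 : (((SimpleFunc.piecewise s hs (SimpleFunc.const α c)
        (SimpleFunc.const α 0)).memLp_of_isFiniteMeasure p μ).toLp _) =
        indicatorConstLp p hs (measure_ne_top μ _) c := by
      ext1
      refine (MemLp.coeFn_toLp _).trans ?_
      rw [this]
      exact indicatorConstLp_coeFn.symm
    rw [h2, h _ hs, this, ← integral_indicator hs]
    refine integral_congr_ae (ae_of_all _ fun x => ?_)
    by_cases hx : x ∈ s <;> simp [hx]
  | add _ hf hg =>
    rename_i f g _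
    have e : ((f + g).memLp_of_isFiniteMeasure p μ).toLp (f + g : SimpleFunc α E) =
        (f.memLp_of_isFiniteMeasure p μ).toLp f + (g.memLp_of_isFiniteMeasure p μ).toLp g := rfl
    obtain ⟨C, hC⟩ := f.exists_forall_norm_le
    obtain ⟨D, hD⟩ := g.exists_forall_norm_le
    rw [e, map_add, hf, hg, ← integral_add
      (integrable_inner_of_bound hW f.aestronglyMeasurable hC)
      (integrable_inner_of_bound hW g.aestronglyMeasurable hD)]
    simp [inner_add_right]

/-- At this stage `W` is only integrable, so the pairing is available for bounded `v` only.
Uniformly bounded simple functions converge to `v` both in `L^p` and against `W`. -/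
lemma apply_bounded (hp : p ≠ ⊤) (hW : Integrable W μ)
    (h : ∀ A (hA : MeasurableSet A) (c : E),
      ℓ (indicatorConstLp p hA (measure_ne_top μ _) c) = ∫ x in A, inner ℝ (W x) c ∂μ)
    {v : α → E} (hv : StronglyMeasurable v) {C : ℝ} (hC : ∀ x, ‖v x‖ ≤ C) (hvp : MemLp v p μ) :
    ℓ (hvp.toLp v) = ∫ x, inner ℝ (W x) (v x) ∂μ := by
  rcases isEmpty_or_nonempty α with _ | ⟨⟨x0⟩⟩
  · have : hvp.toLp v = 0 := by
      ext1; exact ae_of_all _ fun x => isEmptyElim x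
    rw [this, map_zero, integral_eq_zero_of_ae (ae_of_all _ fun x => isEmptyElim x)]
  have hC0 : 0 ≤ C := (norm_nonneg _).trans (hC x0)
  have hp0 : p ≠ 0 := (lt_of_lt_of_le zero_lt_one Fact.out).ne'
  have hlim : ∀ x, Tendsto (fun n => hv.approxBounded C n x) atTop (𝓝 (v x)) := fun x =>
    StronglyMeasurable.tendsto_approxBounded_of_norm_le hv (hC x)
  have hb : ∀ n x, ‖hv.approxBounded C n x‖ ≤ C := fun n x =>
    hv.norm_approxBounded_le hC0 n x
  have h1 : Tendsto (fun n => ((hv.approxBounded C n).memLp_of_isFiniteMeasure p μ).toLp _) atTop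
      (𝓝 (hvp.toLp v)) := by
    rw [Lp.tendsto_Lp_iff_tendsto_eLpNorm'']
    refine tendsto_eLpNorm_of_bounded hp0 hp (C := C + C)
      (fun n => (hv.approxBounded C n).aestronglyMeasurable)
      hv.aestronglyMeasurable (fun n x => ?_) (ae_of_all _ hlim)
    exact (norm_sub_le _ _).trans (add_le_add (hb n x) (hC x))
  have h2 := (ℓ.continuous.tendsto _).comp h1
  have h3 : Tendsto (fun n => ∫ x, inner ℝ (W x) (hv.approxBounded C n x) ∂μ) atTop
      (𝓝 (∫ x, inner ℝ (W x) (v x) ∂μ)) := by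
    refine tendsto_integral_of_dominated_convergence (fun x => ‖W x‖ * C)
      (fun n => hW.1.inner (hv.approxBounded C n).aestronglyMeasurable) (hW.norm.mul_const C)
      (fun n => ae_of_all _ fun x => ?_) (ae_of_all _ fun x => ?_)
    · exact (norm_inner_le_norm _ _).trans (mul_le_mul_of_nonneg_left (hb n x) (norm_nonneg _))
    · exact tendsto_const_nhds.inner (hlim x)
  refine tendsto_nhds_unique h2 (h3.congr fun n => ?_)
  exact (apply_simpleFunc hW h _).symm

/-- The functional is tested on the extremal field of Hölder's inequality, `|W|^(q-2) W`, truncated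
to `{|W| ≤ n}` to keep it bounded. With `I` the integral of `|W|^q` over that set this gives `I ≤
‖ℓ‖ I^(1/p)`, hence `I^(1/q) ≤ ‖ℓ‖`. Fatou removes the truncation. -/
lemma eLpNorm_density_le_of_ne_top {q : ℝ≥0∞} [Fact (1 ≤ q)] [ENNReal.HolderConjugate p q]
    (hp : p ≠ ⊤) (hq : q ≠ ⊤) (hWm : StronglyMeasurable W) (hW : Integrable W μ)
    (h : ∀ A (hA : MeasurableSet A) (c : E),
      ℓ (indicatorConstLp p hA (measure_ne_top μ _) c) = ∫ x in A, inner ℝ (W x) c ∂μ) :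
    eLpNorm W q μ ≤ ENNReal.ofReal ‖ℓ‖ := by
  have hp0 : p ≠ 0 := (lt_of_lt_of_le zero_lt_one Fact.out).ne'
  have hq0 : q ≠ 0 := (lt_of_lt_of_le zero_lt_one Fact.out).ne'
  have hpq : p.toReal.HolderConjugate q.toReal := ENNReal.HolderConjugate.toReal_of_ne_top hp hq
  set P := p.toReal
  set r := q.toReal
  have hr : 1 < r := hpq.symm.lt
  have hS : ∀ n : ℕ, MeasurableSet {x | ‖W x‖ ≤ n} := fun n =>
    hWm.norm.measurable measurableSet_Iic
  have key : ∀ n : ℕ, eLpNorm ({x | ‖W x‖ ≤ n}.indicator W) q μ ≤ ENNReal.ofReal ‖ℓ‖ := by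
    intro n
    set S := {x | ‖W x‖ ≤ n} with hSdef
    set v : α → E := S.indicator fun x => ‖W x‖ ^ (r - 2) • W x with hv
    have hnorm : ∀ x, ‖‖W x‖ ^ (r - 2) • W x‖ = ‖W x‖ ^ (r - 1) := by
      intro x
      rcases (norm_nonneg (W x)).eq_or_lt with h0 | h0
      · rw [norm_smul, ← h0, mul_zero, Real.zero_rpow (by linarith)]
      · rw [norm_smul, Real.norm_of_nonneg (by positivity), ← Real.rpow_add_one h0.ne']
        congr 1; ring
    have hvm : StronglyMeasurable v :=
      (((hWm.norm.measurable.pow_const _).stronglyMeasurable).smul hWm).indicator (hS n)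
    have hvb : ∀ x, ‖v x‖ ≤ (n : ℝ) ^ (r - 1) := by
      intro x
      by_cases hx : x ∈ S
      · rw [hv, indicator_of_mem hx, hnorm]
        exact Real.rpow_le_rpow (norm_nonneg _) hx (by linarith)
      · rw [hv, indicator_of_notMem hx, norm_zero]; positivity
    have hvp : MemLp v p μ := MemLp.of_bound hvm.aestronglyMeasurable _ (ae_of_all _ hvb)
    have hI := apply_bounded hp hW h hvm hvb hvp
    have e1 : ∀ x, inner ℝ (W x) (v x) = S.indicator (fun x => ‖W x‖ ^ r) x := by
      intro x
      by_cases hx : x ∈ S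
      · rw [hv, indicator_of_mem hx, indicator_of_mem hx, inner_smul_right,
          real_inner_self_eq_norm_sq]
        rcases (norm_nonneg (W x)).eq_or_lt with h0 | h0
        · rw [← h0, Real.zero_rpow (by linarith : r ≠ 0)]; simp
        · rw [← Real.rpow_natCast, ← Real.rpow_add h0]; norm_num
      · rw [hv, indicator_of_notMem hx, indicator_of_notMem hx, inner_zero_right]
    have e2 : ∀ x, ‖v x‖ ^ P = S.indicator (fun x => ‖W x‖ ^ r) x := by
      intro x
      by_cases hx : x ∈ S
      · rw [hv, indicator_of_mem hx, indicator_of_mem hx, hnorm, ← Real.rpow_mul (norm_nonneg _),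
          hpq.symm.sub_one_mul_conj]
      · rw [hv, indicator_of_notMem hx, indicator_of_notMem hx, norm_zero,
          Real.zero_rpow hpq.ne_zero]
    have e3 : ∀ x, ‖S.indicator W x‖ ^ r = S.indicator (fun x => ‖W x‖ ^ r) x := by
      intro x
      by_cases hx : x ∈ S
      · rw [indicator_of_mem hx, indicator_of_mem hx]
      · rw [indicator_of_notMem hx, indicator_of_notMem hx, norm_zero,
          Real.zero_rpow (by linarith)]
    have hWq : MemLp (S.indicator W) q μ := by
      refine MemLp.of_bound (hWm.indicator (hS n)).aestronglyMeasurable n (ae_of_all _ fun x => ?_)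
      by_cases hx : x ∈ S
      · rw [indicator_of_mem hx]; exact hx
      · rw [indicator_of_notMem hx, norm_zero]; positivity
    set I := ∫ x, S.indicator (fun x => ‖W x‖ ^ r) x ∂μ with hIdef
    have hI0 : 0 ≤ I := integral_nonneg fun x => indicator_nonneg (fun _ _ => by positivity) _
    have hle := (le_abs_self _).trans (ℓ.le_opNorm (hvp.toLp v))
    rw [Lp.norm_toLp, hvp.eLpNorm_eq_integral_rpow_norm hp0 hp, hI,
      ENNReal.toReal_ofReal (by positivity)] at hle
    simp only [e1] at hle
    change I ≤ ‖ℓ‖ * (∫ x, ‖v x‖ ^ P ∂μ) ^ P⁻¹ at hle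
    simp only [e2] at hle
    rw [← hIdef] at hle
    rw [hWq.eLpNorm_eq_integral_rpow_norm hq0 hq]
    refine ENNReal.ofReal_le_ofReal ?_
    change (∫ x, ‖S.indicator W x‖ ^ r ∂μ) ^ r⁻¹ ≤ _
    simp only [e3]
    rw [← hIdef]
    rcases hI0.eq_or_lt with h0 | h0
    · rw [← h0, Real.zero_rpow (inv_ne_zero (by linarith))]; positivity
    · have h1 : I = I ^ r⁻¹ * I ^ P⁻¹ := by
        rw [← Real.rpow_add h0, add_comm, hpq.inv_add_inv_eq_one, Real.rpow_one]
      rw [h1] at hle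
      exact le_of_mul_le_mul_right (by rwa [← h1] at hle ⊢) (Real.rpow_pos_of_pos h0 P⁻¹)
  refine (Lp.eLpNorm_lim_le_liminf_eLpNorm
    (fun n => (hWm.indicator (hS n)).aestronglyMeasurable) W (ae_of_all _ fun x => ?_)).trans ?_
  · obtain ⟨N, hN⟩ := exists_nat_ge ‖W x‖
    refine tendsto_const_nhds.congr' ?_
    filter_upwards [eventually_ge_atTop N] with n hn
    rw [indicator_of_mem]
    exact hN.trans (by exact_mod_cast hn)
  · refine liminf_le_of_frequently_le' (Frequently.of_forall key)

/-- Testing on the unit field `W/|W|` over `A = {|W| > ‖ℓ‖}` gives `∫_A |W| ≤ ‖ℓ‖ μ(A)`; the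
integrand `|W| - ‖ℓ‖` is positive on `A`, so `A` is null. -/
lemma eLpNorm_density_le_of_one (hp1 : p = 1) (hWm : StronglyMeasurable W) (hW : Integrable W μ)
    (h : ∀ A (hA : MeasurableSet A) (c : E),
      ℓ (indicatorConstLp p hA (measure_ne_top μ _) c) = ∫ x in A, inner ℝ (W x) c ∂μ) :
    eLpNorm W ⊤ μ ≤ ENNReal.ofReal ‖ℓ‖ := by
  subst hp1
  set A := {x | ‖ℓ‖ < ‖W x‖} with hA
  have hAm : MeasurableSet A := hWm.norm.measurable measurableSet_Ioi
  set v : α → E := A.indicator fun x => ‖W x‖⁻¹ • W x with hv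
  have hvm : StronglyMeasurable v :=
    ((hWm.norm.measurable.inv.stronglyMeasurable).smul hWm).indicator hAm
  have hvn : ∀ x, ‖v x‖ = A.indicator (fun _ => (1 : ℝ)) x := by
    intro x
    by_cases hx : x ∈ A
    · have : ‖W x‖ ≠ 0 := ((norm_nonneg ℓ).trans_lt hx).ne'
      rw [hv, indicator_of_mem hx, indicator_of_mem hx, norm_smul, norm_inv, norm_norm,
        inv_mul_cancel₀ this]
    · rw [hv, indicator_of_notMem hx, indicator_of_notMem hx, norm_zero]
  have hvb : ∀ x, ‖v x‖ ≤ 1 := fun x => by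
    rw [hvn]; exact indicator_le_self' (f := fun _ => (1 : ℝ)) (fun _ _ => zero_le_one) x
  have hvp : MemLp v 1 μ := MemLp.of_bound hvm.aestronglyMeasurable _ (ae_of_all _ hvb)
  have hI := apply_bounded ENNReal.one_ne_top hW h hvm hvb hvp
  have e1 : ∀ x, inner ℝ (W x) (v x) = A.indicator (fun x => ‖W x‖) x := by
    intro x
    by_cases hx : x ∈ A
    · have : ‖W x‖ ≠ 0 := ((norm_nonneg ℓ).trans_lt hx).ne'
      rw [hv, indicator_of_mem hx, indicator_of_mem hx, inner_smul_right,
        real_inner_self_eq_norm_sq]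
      field_simp
    · rw [hv, indicator_of_notMem hx, indicator_of_notMem hx, inner_zero_right]
  have hle := (le_abs_self _).trans (ℓ.le_opNorm (hvp.toLp v))
  rw [Lp.norm_toLp, hvp.eLpNorm_eq_integral_rpow_norm one_ne_zero ENNReal.one_ne_top, hI,
    ENNReal.toReal_ofReal (by positivity)] at hle
  simp only [e1, hvn, ENNReal.toReal_one, Real.rpow_one, inv_one] at hle
  rw [integral_indicator hAm, integral_indicator hAm] at hle
  have h1 : ∫ x in A, (‖W x‖ - ‖ℓ‖) ∂μ ≤ 0 := by
    rw [integral_sub hW.norm.integrableOn (integrable_const _)]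
    simp only [integral_const, smul_eq_mul, mul_one] at hle ⊢
    linarith
  have h2 : μ A = 0 := by
    by_contra hne
    have hpos : 0 < ∫ x in A, (‖W x‖ - ‖ℓ‖) ∂μ := by
      rw [setIntegral_pos_iff_support_of_nonneg_ae]
      · refine lt_of_lt_of_le (pos_iff_ne_zero.2 hne) (measure_mono fun x hx => ⟨?_, hx⟩)
        exact (sub_pos.2 hx).ne'
      · filter_upwards [ae_restrict_mem hAm] with x hx
        exact (sub_pos.2 hx).le
      · exact hW.norm.integrableOn.sub (integrable_const _)
    linarith
  refine eLpNormEssSup_le_of_ae_bound ?_ |>.trans' (by rw [eLpNorm_exponent_top])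
  rw [ae_iff]
  simpa using h2

end Riesz

section Final

variable {α : Type*} [MeasurableSpace α] {μ : Measure α} [IsFiniteMeasure μ]
  {ι : Type*} [Fintype ι] {p q : ℝ≥0∞} [Fact (1 ≤ p)] [Fact (1 ≤ q)]

/-- Riesz representation of the dual of `L^p(μ; ℝⁿ)`, `1 ≤ p < ∞`, for a finite measure. -/
theorem exists_lpPairing_eq [ENNReal.HolderConjugate p q]
    (hp : p ≠ ⊤)
    (ℓ : StrongDual ℝ (Lp (EuclideanSpace ℝ ι) p μ)) :
    ∃ w : Lp (EuclideanSpace ℝ ι) q μ, (innerSL ℝ).lpPairing μ q p w = ℓ ∧ ‖w‖ ≤ ‖ℓ‖ := by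
  obtain ⟨W, hWm, hW, h⟩ := exists_vector_density hp ℓ
  have hle : eLpNorm W q μ ≤ ENNReal.ofReal ‖ℓ‖ := by
    by_cases hq : q = ⊤
    · have hp1 : p = 1 := by
        have := ENNReal.HolderConjugate.inv_add_inv_eq_one p q
        rw [hq, ENNReal.inv_top, add_zero] at this
        exact ENNReal.inv_eq_one.1 this
      rw [hq]
      exact eLpNorm_density_le_of_one hp1 hWm hW h
    · exact eLpNorm_density_le_of_ne_top hp hq hWm hW h
  have hWq : MemLp W q μ := ⟨hWm.aestronglyMeasurable, hle.trans_lt ENNReal.ofReal_lt_top⟩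
  refine ⟨hWq.toLp W, ?_, ?_⟩
  · ext f
    induction f using Lp.induction hp with
    | indicatorConst c hs hμs =>
      rename_i s
      have e : ((Lp.simpleFunc.indicatorConst p hs hμs.ne c : Lp.simpleFunc _ p μ) :
        Lp (EuclideanSpace ℝ ι) p μ) = indicatorConstLp p hs hμs.ne c := rfl
      rw [e, h s hs c, ContinuousLinearMap.lpPairing_eq_integral, ← integral_indicator hs]
      refine integral_congr_ae ?_
      filter_upwards [hWq.coeFn_toLp, indicatorConstLp_coeFn (p := p) (hs := hs)
        (hμs := hμs.ne) (c := c)] with x h1 h2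
      rw [h1, h2]
      by_cases hx : x ∈ s
      · rw [indicator_of_mem hx, indicator_of_mem hx]
        rfl
      · rw [indicator_of_notMem hx, indicator_of_notMem hx, map_zero]
    | add hf hg _ h1 h2 => rw [map_add, map_add, h1, h2]
    | isClosed => exact isClosed_eq (ContinuousLinearMap.continuous _) ℓ.continuous
  · rw [Lp.norm_toLp]
    exact ENNReal.toReal_le_of_le_ofReal (norm_nonneg _) hle

end Final

/-! ### Hahn–Banach and the duality between fluxes and functionals. -/

section

/-- As `X` is only seminormed, `T` need not be injective. `L` is transported to the range by an
algebraic right inverse `g`; `g (T x)` and `x` differ by an element of seminorm zero, which the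
continuous `L` kills. -/
lemma exists_extension_of_norm_map {X Y : Type*} [SeminormedAddCommGroup X] [NormedSpace ℝ X]
    [NormedAddCommGroup Y] [NormedSpace ℝ Y] (T : X →L[ℝ] Y) (hT : ∀ x, ‖T x‖ = ‖x‖)
    (L : StrongDual ℝ X) : ∃ ℓ : StrongDual ℝ Y, ℓ.comp T = L ∧ ‖ℓ‖ = ‖L‖ := by
  let T' : X →ₗ[ℝ] Y := T
  obtain ⟨g, hg⟩ := T'.rangeRestrict.exists_rightInverse_of_surjective T'.range_rangeRestrict
  have hg' : ∀ y : LinearMap.range T', T (g y) = y := fun y =>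
    congrArg Subtype.val (LinearMap.congr_fun hg y)
  let f : StrongDual ℝ (LinearMap.range T') :=
    ((L : X →ₗ[ℝ] ℝ) ∘ₗ g).mkContinuous ‖L‖ fun y => by
      refine (L.le_opNorm (g y)).trans_eq ?_
      rw [← hT, hg', Submodule.coe_norm]
  obtain ⟨ℓ, hℓ, hn⟩ := _root_.exists_extension_norm_eq _ f
  have hcomp : ℓ.comp T = L := by
    ext x
    have h1 : ℓ (T x) = L (g ⟨T x, x, rfl⟩) := hℓ ⟨T x, x, rfl⟩
    have h2 : ‖g ⟨T x, x, rfl⟩ - x‖ = 0 := by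
      rw [← hT, map_sub, hg', sub_self, norm_zero]
    have h3 : ‖L (g ⟨T x, x, rfl⟩ - x)‖ ≤ 0 := by
      simpa [h2] using L.le_opNorm (g ⟨T x, x, rfl⟩ - x)
    rw [map_sub, norm_le_zero_iff, sub_eq_zero] at h3
    rw [ContinuousLinearMap.comp_apply, h1, h3]
  refine ⟨ℓ, hcomp, le_antisymm ?_ ?_⟩
  · rw [hn]
    exact LinearMap.mkContinuous_norm_le _ (norm_nonneg _) _
  · refine L.opNorm_le_bound (norm_nonneg _) fun x => ?_
    rw [← hcomp, ← hT]
    exact ℓ.le_opNorm _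

/-- Replacing `x` by `-x` supplies the absolute value. A nonzero vector is required because every
real number bounds the empty set. Nonzero vectors of seminorm zero contribute only the value `0`. -/
lemma isLUB_ratio {X : Type*} [SeminormedAddCommGroup X] [NormedSpace ℝ X] (L : StrongDual ℝ X)
    (hX : ∃ x : X, x ≠ 0) : IsLUB {c : ℝ | ∃ x : X, x ≠ 0 ∧ c = L x / ‖x‖} ‖L‖ := by
  constructor
  · rintro _ ⟨x, _, rfl⟩
    exact div_le_of_le_mul₀ (norm_nonneg _) (norm_nonneg _) ((le_abs_self _).trans (L.le_opNorm x))
  · intro b hb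
    have h1 : ∀ x : X, x ≠ 0 → |L x| / ‖x‖ ≤ b := by
      intro x hx
      rcases abs_cases (L x) with ⟨h, _⟩ | ⟨h, _⟩
      · rw [h]; exact hb ⟨x, hx, rfl⟩
      · rw [h]; exact hb ⟨-x, neg_ne_zero.2 hx, by rw [map_neg, norm_neg]⟩
    have hb0 : 0 ≤ b := by
      obtain ⟨x, hx⟩ := hX
      exact le_trans (by positivity) (h1 x hx)
    refine L.opNorm_le_bound hb0 fun x => ?_
    rcases (norm_nonneg x).eq_or_lt with h0 | h0
    · simpa [← h0] using L.le_opNorm x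
    · have hx : x ≠ 0 := by rintro rfl; simp at h0
      exact (div_le_iff₀ h0).1 (h1 x hx)

variable {Ω : Set E3} {p q : ℝ≥0∞} [Fact (1 ≤ p)]

lemma norm_gradDot (ψ : WDot Ω p) : ‖gradDot ψ‖ = ‖ψ‖ := rfl

lemma norm_eq_integral_rpow (hp : p ≠ ⊤) (ψ : WDot Ω p) :
    ‖ψ‖ = (∫ x in Ω, ‖gradDot ψ x‖ ^ p.toReal) ^ (1 / p.toReal) := by
  rw [← norm_gradDot, Lp.norm_def, (Lp.memLp _).eLpNorm_eq_integral_rpow_norm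
    (lt_of_lt_of_le zero_lt_one Fact.out).ne' hp, ENNReal.toReal_ofReal (by positivity), one_div]

variable [Fact (1 ≤ q)] [ENNReal.HolderConjugate p q]

lemma norm_fluxFunctional_le (w : Lp E3 q (volOn Ω)) :
    ‖(fluxFunctional w : StrongDual ℝ (Lp E3 p (volOn Ω)))‖ ≤ ‖w‖ := by
  refine ContinuousLinearMap.opNorm_le_bound _ (norm_nonneg _) fun v => ?_
  change ‖(innerSL ℝ).lpPairing (volOn Ω) q p w v‖ ≤ _
  rw [ContinuousLinearMap.lpPairing_eq_integral]
  have h1 : ‖(innerSL ℝ : E3 →L[ℝ] E3 →L[ℝ] ℝ).holder 1 w v‖ ≤ ‖w‖ * ‖v‖ := by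
    refine (ContinuousLinearMap.norm_holder_apply_apply_le _ w v).trans ?_
    gcongr
    exact mul_le_of_le_one_left (norm_nonneg _) (norm_innerSL_le ℝ)
  refine le_trans (le_of_eq ?_) ((norm_integral_le_integral_norm _).trans
    ((L1.norm_eq_integral_norm _).symm.le.trans h1))
  congr 1
  exact (integral_congr_ae (ContinuousLinearMap.coeFn_holder _ _ _)).symm

/-- Hahn–Banach and Riesz produce one representing field of norm at most `‖L‖`; Hölder shows that no
representing field has smaller norm. So the infimum is a minimum. -/
theorem exists_optimal_flux [IsFiniteMeasure (volOn Ω)] (hp : p ≠ ⊤)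
    (L : StrongDual ℝ (WDot Ω p)) :
    ∃ w : Lp E3 q (volOn Ω), L = gradDual w ∧
      sInf {c : ℝ | ∃ w : Lp E3 q (volOn Ω), L = gradDual w ∧ c = ‖w‖} = ‖w‖ ∧ ‖w‖ = ‖L‖ := by
  obtain ⟨ℓ, hℓ, hn⟩ := exists_extension_of_norm_map gradDot norm_gradDot L
  obtain ⟨w, hw, hwn⟩ := exists_lpPairing_eq (q := q) hp ℓ
  have hge : ∀ w' : Lp E3 q (volOn Ω), L = gradDual w' → ‖L‖ ≤ ‖w'‖ := by
    rintro w' rfl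
    refine ContinuousLinearMap.opNorm_le_bound _ (norm_nonneg _) fun ψ => ?_
    refine ((fluxFunctional w').le_opNorm (gradDot ψ)).trans ?_
    rw [norm_gradDot]
    gcongr
    exact norm_fluxFunctional_le w'
  have hLw : L = gradDual w := by
    rw [← hℓ, ← hw]; rfl
  have heq : ‖w‖ = ‖L‖ := le_antisymm (hwn.trans hn.le) (hge w hLw)
  refine ⟨w, hLw, ?_, heq⟩
  have : IsLeast {c : ℝ | ∃ w : Lp E3 q (volOn Ω), L = gradDual w ∧ c = ‖w‖} ‖w‖ := by
    refine ⟨⟨w, hLw, rfl⟩, ?_⟩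
    rintro _ ⟨w', h', rfl⟩
    exact heq.le.trans (hge w' h')
  exact this.csInf_eq

lemma deltaDual_apply (δ : WDot Ω p →L[ℝ] Lp ℝ p (volOn Ω) × Lp ℝ p (areaOn Ω))
    (hδ : ∀ ψ, (δ ψ).1 = ψ.toLp) (β : Lp ℝ q (volOn Ω)) (τ : Lp ℝ q (areaOn Ω)) (ψ : WDot Ω p) :
    deltaDual δ β τ ψ =
      (∫ x in Ω, β x * ψ.toLp x) + ∫ x, τ x * (δ ψ).2 x ∂(areaOn Ω) := by
  rw [← hδ]
  change (ContinuousLinearMap.mul ℝ ℝ).lpPairing (volOn Ω) q p β (δ ψ).1 +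
    (ContinuousLinearMap.mul ℝ ℝ).lpPairing (areaOn Ω) q p τ (δ ψ).2 = _
  rw [ContinuousLinearMap.lpPairing_eq_integral, ContinuousLinearMap.lpPairing_eq_integral]
  rfl

end

/-! ### The Poincaré inequality for smooth functions, from local to global. -/

/-- Jensen's inequality, used below for averages along segments and for averages against a
mollifier. -/
lemma rpow_lintegral_enorm_le {α F : Type*} [MeasurableSpace α] [NormedAddCommGroup F]
    {ν : Measure α} [IsProbabilityMeasure ν] {f : α → F} (hf : AEStronglyMeasurable f ν) {r : ℝ}
    (hr : 1 ≤ r) : (∫⁻ t, ‖f t‖ₑ ∂ν) ^ r ≤ ∫⁻ t, ‖f t‖ₑ ^ r ∂ν := by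
  have h := eLpNorm'_le_eLpNorm'_of_exponent_le zero_lt_one hr ν hf
  simp only [eLpNorm', ENNReal.rpow_one, div_one] at h
  calc (∫⁻ t, ‖f t‖ₑ ∂ν) ^ r ≤ ((∫⁻ t, ‖f t‖ₑ ^ r ∂ν) ^ (1 / r)) ^ r :=
        ENNReal.rpow_le_rpow h (by linarith)
    _ = _ := by rw [← ENNReal.rpow_mul, one_div, inv_mul_cancel₀ (by linarith), ENNReal.rpow_one]

lemma one_le_toReal {p : ℝ≥0∞} [Fact (1 ≤ p)] (hp : p ≠ ⊤) : 1 ≤ p.toReal := by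
  have : (1 : ℝ≥0∞) ≤ p := Fact.out
  simpa using (ENNReal.toReal_le_toReal ENNReal.one_ne_top hp).2 this

lemma eLpNorm_rpow {α F : Type*} [MeasurableSpace α] [NormedAddCommGroup F] {ν : Measure α}
    {p : ℝ≥0∞} (hp0 : p ≠ 0) (hp : p ≠ ⊤) (f : α → F) :
    eLpNorm f p ν ^ p.toReal = ∫⁻ x, ‖f x‖ₑ ^ p.toReal ∂ν := by
  have := (ENNReal.toReal_pos hp0 hp).ne'
  rw [eLpNorm_eq_lintegral_rpow_enorm_toReal hp0 hp, ← ENNReal.rpow_mul, one_div,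
    inv_mul_cancel₀ this, ENNReal.rpow_one]

section Translation

variable {E : Type*} [NormedAddCommGroup E] [NormedSpace ℝ E]

/-- Fundamental theorem of calculus along the segment, then Jensen. The integral over `(0, a]` is
enlarged to `(0, 1]` so that the bound does not depend on `a`, which the trace inequality exploits
by averaging over `a`. -/
lemma enorm_sub_smul_rpow_le {φ : E → ℝ} (hφ : ContDiff ℝ ∞ φ) (x z : E) {a : ℝ}
    (ha : a ∈ Icc (0 : ℝ) 1) {r : ℝ} (hr : 1 ≤ r) :
    ‖φ (x + a • z) - φ x‖ₑ ^ r ≤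
      ‖z‖ₑ ^ r * ∫⁻ t in Ioc (0 : ℝ) 1, ‖fderiv ℝ φ (x + t • z)‖ₑ ^ r := by
  have hd : ∀ t : ℝ, HasDerivAt (fun t : ℝ => φ (x + t • z)) (fderiv ℝ φ (x + t • z) z) t := by
    intro t
    have h1 : HasDerivAt (fun t : ℝ => x + t • z) z t := by
      simpa using ((hasDerivAt_id t).smul_const z).const_add x
    exact ((hφ.differentiable (by simp)) _).hasFDerivAt.comp_hasDerivAt t h1
  have hcf : Continuous fun t : ℝ => fderiv ℝ φ (x + t • z) :=
    (hφ.continuous_fderiv (by simp)).comp (by fun_prop)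
  have hc : Continuous fun t : ℝ => fderiv ℝ φ (x + t • z) z := hcf.clm_apply continuous_const
  have hI := intervalIntegral.integral_eq_sub_of_hasDerivAt (a := 0) (b := a)
    (fun t _ => hd t) (hc.intervalIntegrable _ _)
  simp only [zero_smul, add_zero] at hI
  rw [← hI, intervalIntegral.integral_of_le ha.1]
  have : IsProbabilityMeasure (volume.restrict (Ioc (0 : ℝ) 1)) := ⟨by simp⟩
  calc ‖∫ t in Ioc (0 : ℝ) a, fderiv ℝ φ (x + t • z) z‖ₑ ^ r
      ≤ (∫⁻ t in Ioc (0 : ℝ) a, ‖fderiv ℝ φ (x + t • z) z‖ₑ) ^ r :=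
        ENNReal.rpow_le_rpow (enorm_integral_le_lintegral_enorm _) (by linarith)
    _ ≤ (∫⁻ t in Ioc (0 : ℝ) 1, ‖fderiv ℝ φ (x + t • z) z‖ₑ) ^ r :=
        ENNReal.rpow_le_rpow (lintegral_mono_set (Ioc_subset_Ioc_right ha.2)) (by linarith)
    _ ≤ ∫⁻ t in Ioc (0 : ℝ) 1, ‖fderiv ℝ φ (x + t • z) z‖ₑ ^ r :=
        rpow_lintegral_enorm_le hc.aestronglyMeasurable hr
    _ ≤ ∫⁻ t in Ioc (0 : ℝ) 1, ‖z‖ₑ ^ r * ‖fderiv ℝ φ (x + t • z)‖ₑ ^ r := by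
        refine lintegral_mono fun t => ?_
        rw [← ENNReal.mul_rpow_of_nonneg _ _ (by linarith), mul_comm]
        exact ENNReal.rpow_le_rpow (ContinuousLinearMap.le_opENorm _ _) (by linarith)
    _ = _ := by
        rw [lintegral_const_mul]
        exact (hcf.enorm.measurable).pow_const _

lemma enorm_sub_rpow_le {φ : E → ℝ} (hφ : ContDiff ℝ ∞ φ) (x z : E) {r : ℝ} (hr : 1 ≤ r) :
    ‖φ (x + z) - φ x‖ₑ ^ r ≤
      ‖z‖ₑ ^ r * ∫⁻ t in Ioc (0 : ℝ) 1, ‖fderiv ℝ φ (x + t • z)‖ₑ ^ r := by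
  simpa using enorm_sub_smul_rpow_le hφ x z (right_mem_Icc.2 zero_le_one) hr

variable [MeasurableSpace E] [BorelSpace E] [FiniteDimensional ℝ E] {μ : Measure E}
  [μ.IsAddHaarMeasure]

omit [NormedSpace ℝ E] [FiniteDimensional ℝ E] in
lemma setLIntegral_comp_add_le {S U : Set E} (hS : MeasurableSet S) (hU : MeasurableSet U) {z : E}
    (h : ∀ x ∈ S, x + z ∈ U) (f : E → ℝ≥0∞) :
    ∫⁻ x in S, f (x + z) ∂μ ≤ ∫⁻ x in U, f x ∂μ := by
  rw [← lintegral_indicator hS, ← lintegral_indicator hU,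
    ← lintegral_add_right_eq_self (U.indicator f) z]
  refine lintegral_mono fun x => ?_
  by_cases hx : x ∈ S
  · rw [indicator_of_mem hx, indicator_of_mem (h x hx)]
  · rw [indicator_of_notMem hx]
    exact zero_le

/-- By Tonelli the segment parameter can be frozen; for each `t` the translate of `S` by `t • z`
lies in `U`, and the measure is translation invariant. -/
lemma lintegral_sub_translate_le {φ : E → ℝ} (hφ : ContDiff ℝ ∞ φ) {S U : Set E}
    (hS : MeasurableSet S) (hU : MeasurableSet U) {z : E}
    (h : ∀ x ∈ S, ∀ t ∈ Ioc (0 : ℝ) 1, x + t • z ∈ U) {r : ℝ} (hr : 1 ≤ r) :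
    ∫⁻ x in S, ‖φ (x + z) - φ x‖ₑ ^ r ∂μ ≤ ‖z‖ₑ ^ r * ∫⁻ x in U, ‖fderiv ℝ φ x‖ₑ ^ r ∂μ := by
  have hm : Measurable fun q : E × ℝ => ‖fderiv ℝ φ (q.1 + q.2 • z)‖ₑ ^ r :=
    ((((hφ.continuous_fderiv (by simp)).comp
      (by fun_prop : Continuous fun q : E × ℝ => q.1 + q.2 • z)).enorm).measurable).pow_const _
  calc ∫⁻ x in S, ‖φ (x + z) - φ x‖ₑ ^ r ∂μ
      ≤ ∫⁻ x in S, ‖z‖ₑ ^ r * (∫⁻ t in Ioc (0 : ℝ) 1, ‖fderiv ℝ φ (x + t • z)‖ₑ ^ r) ∂μ :=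
        lintegral_mono fun x => enorm_sub_rpow_le hφ x z hr
    _ = ‖z‖ₑ ^ r * ∫⁻ x in S, (∫⁻ t in Ioc (0 : ℝ) 1, ‖fderiv ℝ φ (x + t • z)‖ₑ ^ r) ∂μ :=
        lintegral_const_mul _ hm.lintegral_prod_right'
    _ = ‖z‖ₑ ^ r * ∫⁻ t in Ioc (0 : ℝ) 1, (∫⁻ x in S, ‖fderiv ℝ φ (x + t • z)‖ₑ ^ r ∂μ) := by
        rw [lintegral_lintegral_swap hm.aemeasurable]
    _ ≤ ‖z‖ₑ ^ r * ∫⁻ t in Ioc (0 : ℝ) 1, (∫⁻ x in U, ‖fderiv ℝ φ x‖ₑ ^ r ∂μ) := by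
        refine mul_le_mul_right ?_ _
        refine setLIntegral_mono' measurableSet_Ioc fun t ht => ?_
        exact setLIntegral_comp_add_le hS hU (fun x hx => h x hx t ht)
          fun x => ‖fderiv ℝ φ x‖ₑ ^ r
    _ = _ := by simp

/-- A set `V` on which smooth functions satisfy the Poincaré inequality, up to a constant and with
the gradient taken over `Ω`. -/
def IsPoincareSet (μ : Measure E) (p : ℝ≥0∞) (Ω V : Set E) : Prop :=
  ∃ C : ℝ≥0, ∀ φ : E → ℝ, ContDiff ℝ ∞ φ →
    ∃ c : ℝ, eLpNorm (fun x => φ x - c) p (μ.restrict V) ≤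
      C * eLpNorm (fderiv ℝ φ) p (μ.restrict Ω)

variable {p : ℝ≥0∞} {Ω V W : Set E}

omit [FiniteDimensional ℝ E] [BorelSpace E] [μ.IsAddHaarMeasure] in
lemma IsPoincareSet.mono (h : IsPoincareSet μ p Ω W) (hVW : V ⊆ W) : IsPoincareSet μ p Ω V := by
  obtain ⟨C, hC⟩ := h
  refine ⟨C, fun φ hφ => ?_⟩
  obtain ⟨c, hc⟩ := hC φ hφ
  exact ⟨c, (eLpNorm_mono_measure _ (Measure.restrict_mono hVW le_rfl)).trans hc⟩

omit [BorelSpace E] [FiniteDimensional ℝ E] [μ.IsAddHaarMeasure] in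
lemma IsPoincareSet.mono_domain {Ω' : Set E} (h : IsPoincareSet μ p Ω V) (hΩ : Ω ⊆ Ω') :
    IsPoincareSet μ p Ω' V := by
  obtain ⟨C, hC⟩ := h
  refine ⟨C, fun φ hφ => ?_⟩
  obtain ⟨c, hc⟩ := hC φ hφ
  refine ⟨c, hc.trans ?_⟩
  gcongr

omit [FiniteDimensional ℝ E] [μ.IsAddHaarMeasure] in
-- The constants `c` and `d` of the two sets can be compared on the overlap, which has positive
-- measure; then `c` serves on `W` as well, at the cost of the norm of `c - d`.
lemma IsPoincareSet.union [Fact (1 ≤ p)] (hp : p ≠ ⊤) (hV : IsPoincareSet μ p Ω V)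
    (hW : IsPoincareSet μ p Ω W) (hVW : μ (V ∩ W) ≠ 0)
    (hW' : μ W ≠ ⊤) : IsPoincareSet μ p Ω (V ∪ W) := by
  have hp0 : p ≠ 0 := (lt_of_lt_of_le zero_lt_one Fact.out).ne'
  have hr : 0 < p.toReal := ENNReal.toReal_pos hp0 hp
  obtain ⟨C, hC⟩ := hV
  obtain ⟨D, hD⟩ := hW
  -- `m` and `M` are the `L^p` norms of the constant `1` on `V ∩ W` and on `W`.
  set m : ℝ≥0∞ := μ (V ∩ W) ^ (1 / p.toReal)
  set M : ℝ≥0∞ := μ W ^ (1 / p.toReal)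
  have hm0 : m ≠ 0 := by
    have := pos_iff_ne_zero.2 hVW
    exact (ENNReal.rpow_pos this (ne_top_of_le_ne_top hW' (measure_mono inter_subset_right))).ne'
  have hM : M ≠ ⊤ := ENNReal.rpow_ne_top_of_nonneg (by positivity) hW'
  have hm : m ≠ ⊤ := ENNReal.rpow_ne_top_of_nonneg (by positivity)
    (ne_top_of_le_ne_top hW' (measure_mono inter_subset_right))
  have hK : C + (D + M * (m⁻¹ * (C + D))) ≠ ⊤ := by
    finiteness
  refine ⟨(C + (D + M * (m⁻¹ * (C + D)))).toNNReal, fun φ hφ => ?_⟩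
  rw [ENNReal.coe_toNNReal hK]
  obtain ⟨c, hc⟩ := hC φ hφ
  obtain ⟨d, hd⟩ := hD φ hφ
  set N := eLpNorm (fderiv ℝ φ) p (μ.restrict Ω)
  have hφc : ∀ (c : ℝ) (ν : Measure E), AEStronglyMeasurable (fun x => φ x - c) ν := fun c ν =>
    (hφ.continuous.sub continuous_const).aestronglyMeasurable
  have hcd : ‖c - d‖ₑ * m ≤ (C + D) * N := by
    have h1 : eLpNorm (fun _ : E => c - d) p (μ.restrict (V ∩ W)) = ‖c - d‖ₑ * m := by
      rw [eLpNorm_const' _ hp0 hp, Measure.restrict_apply_univ]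
    have h2 : (fun _ : E => c - d) = (fun x => φ x - d) - (fun x => φ x - c) := by
      ext x; simp
    rw [← h1, h2, add_mul, add_comm]
    refine (eLpNorm_sub_le (hφc _ _) (hφc _ _) Fact.out).trans (add_le_add ?_ ?_)
    · exact (eLpNorm_mono_measure _ (Measure.restrict_mono inter_subset_right le_rfl)).trans hd
    · exact (eLpNorm_mono_measure _ (Measure.restrict_mono inter_subset_left le_rfl)).trans hc
  have hcd' : ‖c - d‖ₑ ≤ m⁻¹ * (C + D) * N := by
    rw [mul_assoc, mul_comm, ← div_eq_mul_inv, ENNReal.le_div_iff_mul_le (Or.inl hm0) (Or.inl hm)]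
    exact hcd
  refine ⟨c, ?_⟩
  have h3 : eLpNorm (fun x => φ x - c) p (μ.restrict W) ≤ D * N + M * (m⁻¹ * (C + D) * N) := by
    have : (fun x => φ x - c) = (fun x => φ x - d) - (fun _ => c - d) := by
      ext x; simp
    rw [this]
    refine (eLpNorm_sub_le (hφc _ _) aestronglyMeasurable_const Fact.out).trans
      (add_le_add hd ?_)
    rw [eLpNorm_const' _ hp0 hp, Measure.restrict_apply_univ, mul_comm]
    gcongr
  have h4 : eLpNorm (fun x => φ x - c) p (μ.restrict (V ∪ W)) ≤
      eLpNorm (fun x => φ x - c) p (μ.restrict V) +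
        eLpNorm (fun x => φ x - c) p (μ.restrict W) := by
    refine (eLpNorm_mono_measure _ (Measure.restrict_union_le V W)).trans ?_
    rw [eLpNorm_eq_lintegral_rpow_enorm_toReal hp0 hp,
      eLpNorm_eq_lintegral_rpow_enorm_toReal hp0 hp,
      eLpNorm_eq_lintegral_rpow_enorm_toReal hp0 hp, lintegral_add_measure]
    refine ENNReal.rpow_add_le_add_rpow _ _ (by positivity) ?_
    rw [div_le_one hr]
    exact one_le_toReal hp
  refine h4.trans ((add_le_add hc h3).trans_eq ?_)
  ring

/-- The error splits into `φ(x + z) - c`, controlled on `V`, and the increment `φ(x + z) - φ(x)`,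
controlled by the gradient along segments inside `Ω`. -/
lemma isPoincareSet_of_translate [Fact (1 ≤ p)] (hp : p ≠ ⊤) {S : Set E} {z : E}
    (hS : MeasurableSet S) (hΩ : MeasurableSet Ω) (hV : MeasurableSet V)
    (hPV : IsPoincareSet μ p Ω V) (hSV : ∀ x ∈ S, x + z ∈ V)
    (hSΩ : ∀ x ∈ S, ∀ t ∈ Ioc (0 : ℝ) 1, x + t • z ∈ Ω) : IsPoincareSet μ p Ω S := by
  have hp0 : p ≠ 0 := (lt_of_lt_of_le zero_lt_one Fact.out).ne'
  have hr1 := one_le_toReal hp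
  have hr : 0 < p.toReal := by linarith
  obtain ⟨C, hC⟩ := hPV
  refine ⟨C + ‖z‖₊, fun φ hφ => ?_⟩
  obtain ⟨c, hc⟩ := hC φ hφ
  refine ⟨c, ?_⟩
  have hcont := hφ.continuous
  have : (fun x => φ x - c) = (fun x => φ (x + z) - c) - (fun x => φ (x + z) - φ x) := by
    ext x; simp
  rw [this, ENNReal.coe_add, add_mul]
  refine (eLpNorm_sub_le (by fun_prop) (by fun_prop) Fact.out).trans (add_le_add ?_ ?_)
  · refine le_trans ?_ hc
    rw [← ENNReal.rpow_le_rpow_iff hr, eLpNorm_rpow hp0 hp, eLpNorm_rpow hp0 hp]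
    exact setLIntegral_comp_add_le hS hV hSV fun x => ‖φ x - c‖ₑ ^ p.toReal
  · rw [← ENNReal.rpow_le_rpow_iff hr, eLpNorm_rpow hp0 hp, ENNReal.mul_rpow_of_nonneg _ _ hr.le,
      eLpNorm_rpow hp0 hp]
    exact lintegral_sub_translate_le hφ hS hΩ hSΩ hr1

/-- The double integral of `|φ(y) - φ(x)|^p` over `B × B` is computed with `y = x + z`. Convexity
keeps the segment from `x` to `y` in `B`, and `|z| < 2R`. The constant is `φ(x)` at a point where
the inner integral does not exceed its average. -/
lemma isPoincareSet_ball [Fact (1 ≤ p)] (hp : p ≠ ⊤) (a : E) {R : ℝ} (hR : 0 < R) :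
    IsPoincareSet μ p (Metric.ball a R) (Metric.ball a R) := by
  have hp0 : p ≠ 0 := (lt_of_lt_of_le zero_lt_one Fact.out).ne'
  have hr1 := one_le_toReal hp
  set r := p.toReal
  have hr : 0 < r := by linarith
  set B := Metric.ball a R
  have hBm : MeasurableSet B := Metric.isOpen_ball.measurableSet
  -- The measure of the set of possible differences `z`, times the largest possible `|z|^p`.
  set K : ℝ≥0∞ := μ (Metric.ball 0 (2 * R)) * ENNReal.ofReal (2 * R) ^ r
  have hB0 : μ B ≠ 0 := (Metric.isOpen_ball.measure_pos μ ⟨a, Metric.mem_ball_self hR⟩).ne'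
  have hBt : μ B ≠ ⊤ := measure_ball_lt_top.ne
  have hK : K ≠ ⊤ := ENNReal.mul_ne_top measure_ball_lt_top.ne
    (ENNReal.rpow_ne_top_of_nonneg hr.le ENNReal.ofReal_ne_top)
  have hKB : (K / μ B) ^ (1 / r) ≠ ⊤ :=
    ENNReal.rpow_ne_top_of_nonneg (by positivity) (ENNReal.div_ne_top hK hB0)
  refine ⟨((K / μ B) ^ (1 / r)).toNNReal, fun φ hφ => ?_⟩
  rw [ENNReal.coe_toNNReal hKB]
  have hcont := hφ.continuous
  set G := ∫⁻ x in B, ‖fderiv ℝ φ x‖ₑ ^ r ∂μ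
  have hm : Measurable fun q : E × E => ‖φ (q.1 + q.2) - φ q.1‖ₑ ^ r :=
    ((by fun_prop : Continuous fun q : E × E => φ (q.1 + q.2) - φ q.1).enorm.measurable).pow_const _
  have hm' : Measurable fun q : E × E => ‖φ q.2 - φ q.1‖ₑ ^ r :=
    ((by fun_prop : Continuous fun q : E × E => φ q.2 - φ q.1).enorm.measurable).pow_const _
  have hdouble : ∫⁻ x in B, ∫⁻ y in B, ‖φ y - φ x‖ₑ ^ r ∂μ ∂μ ≤ K * G := by
    set T : Set (E × E) := {q | q.1 ∈ B ∧ q.1 + q.2 ∈ B} with hT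
    have hTm : MeasurableSet T := (measurable_fst hBm).inter
      ((measurable_fst.add measurable_snd) hBm)
    set F : E × E → ℝ≥0∞ := T.indicator fun q => ‖φ (q.1 + q.2) - φ q.1‖ₑ ^ r with hF
    have hFm : Measurable F := hm.indicator hTm
    have h1 : ∫⁻ x in B, ∫⁻ y in B, ‖φ y - φ x‖ₑ ^ r ∂μ ∂μ = ∫⁻ x, ∫⁻ z, F (x, z) ∂μ ∂μ := by
      rw [← lintegral_indicator hBm]
      refine lintegral_congr fun x => ?_
      by_cases hx : x ∈ B
      · rw [indicator_of_mem hx, ← lintegral_indicator hBm, ← lintegral_add_left_eq_self _ x]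
        refine lintegral_congr fun z => ?_
        by_cases hz : x + z ∈ B
        · rw [indicator_of_mem hz, hF, indicator_of_mem (show (x, z) ∈ T from ⟨hx, hz⟩)]
        · rw [indicator_of_notMem hz, hF,
            indicator_of_notMem (show (x, z) ∉ T from fun h => hz h.2)]
      · rw [indicator_of_notMem hx]
        refine Eq.symm (lintegral_eq_zero_of_ae_eq_zero (ae_of_all _ fun z => ?_))
        exact indicator_of_notMem (show (x, z) ∉ T from fun h => hx h.1) _
    have h2 : ∀ z, ∫⁻ x, F (x, z) ∂μ ≤
        (Metric.ball (0 : E) (2 * R)).indicator (fun _ => ENNReal.ofReal (2 * R) ^ r * G) z := by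
      intro z
      have e : ∀ x, F (x, z) =
          (B ∩ {x | x + z ∈ B}).indicator (fun x => ‖φ (x + z) - φ x‖ₑ ^ r) x := fun x => rfl
      have hSm : MeasurableSet (B ∩ {x | x + z ∈ B}) :=
        hBm.inter ((measurable_id.add_const z) hBm)
      simp only [e]
      rw [lintegral_indicator hSm]
      by_cases hz : z ∈ Metric.ball (0 : E) (2 * R)
      · rw [indicator_of_mem hz]
        refine (lintegral_sub_translate_le hφ hSm hBm (fun x hx t ht => ?_) hr1).trans ?_
        · have hcv := (convex_ball a R) hx.1 hx.2 (sub_nonneg.2 ht.2) ht.1.le (by ring)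
          convert hcv using 1
          rw [smul_add, ← add_assoc, ← add_smul]
          simp
        · gcongr
          rw [← ofReal_norm]
          exact ENNReal.ofReal_le_ofReal (mem_ball_zero_iff.1 hz).le
      · rw [indicator_of_notMem hz, nonpos_iff_eq_zero]
        have : B ∩ {x | x + z ∈ B} = ∅ := by
          rw [eq_empty_iff_forall_notMem]
          rintro x ⟨h1, h2⟩
          refine hz (mem_ball_zero_iff.2 ?_)
          have h3 : ‖x - a‖ < R := mem_ball_iff_norm.1 h1
          have h4 : ‖x + z - a‖ < R := mem_ball_iff_norm.1 h2
          have : z = (x + z - a) - (x - a) := by abel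
          rw [this]
          linarith [norm_sub_le (x + z - a) (x - a)]
        rw [this]
        simp
    rw [h1, lintegral_lintegral_swap (f := fun x z => F (x, z)) hFm.aemeasurable]
    refine (lintegral_mono h2).trans_eq ?_
    rw [lintegral_indicator Metric.isOpen_ball.measurableSet, lintegral_const,
      Measure.restrict_apply_univ]
    ring
  obtain ⟨x, _, hx⟩ := exists_le_setLAverage hB0 hBt
    (f := fun x => ∫⁻ y in B, ‖φ y - φ x‖ₑ ^ r ∂μ) hm'.lintegral_prod_right'.aemeasurable
  refine ⟨φ x, ?_⟩
  rw [← ENNReal.rpow_le_rpow_iff hr, eLpNorm_rpow hp0 hp, ENNReal.mul_rpow_of_nonneg _ _ hr.le,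
    eLpNorm_rpow hp0 hp, ← ENNReal.rpow_mul, one_div, inv_mul_cancel₀ hr.ne', ENNReal.rpow_one]
  refine hx.trans ?_
  rw [setLAverage_eq]
  refine (ENNReal.div_le_div_right hdouble _).trans_eq ?_
  rw [ENNReal.mul_comm_div, mul_comm, div_eq_mul_inv, div_eq_mul_inv]
  ring

/-- Among the subfamilies of a finite cover whose union is a Poincaré set, one of largest
cardinality is chosen. By `IsPoincareSet.union` no remaining piece meets it, as an open overlap has
positive measure; connectedness of `Ω` then leaves no point outside. -/
lemma isPoincareSet_of_local [Fact (1 ≤ p)] (hp : p ≠ ⊤) (hΩo : IsOpen Ω)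
    (hΩc : IsConnected Ω) (hΩb : Bornology.IsBounded Ω)
    (h : ∀ x ∈ closure Ω, ∃ U, IsOpen U ∧ x ∈ U ∧ IsPoincareSet μ p Ω (U ∩ Ω)) :
    IsPoincareSet μ p Ω Ω := by
  classical
  choose! U hUo hxU hPU using h
  obtain ⟨t, htc, ht⟩ := hΩb.isCompact_closure.elim_nhds_subcover U
    fun x hx => (hUo x hx).mem_nhds (hxU x hx)
  have hfin : ∀ V ⊆ Ω, μ V ≠ ⊤ := fun V hV =>
    ne_top_of_le_ne_top hΩb.measure_lt_top.ne (measure_mono hV)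
  set V : E → Set E := fun x => U x ∩ Ω
  have hVo : ∀ x ∈ t, IsOpen (V x) := fun x hx => (hUo x (htc x hx)).inter hΩo
  have hVne : ∀ x ∈ t, (V x).Nonempty := fun x hx =>
    mem_closure_iff.1 (htc x hx) _ (hUo x (htc x hx)) (hxU x (htc x hx))
  have htne : t.Nonempty := by
    obtain ⟨y, hy⟩ := hΩc.nonempty
    obtain ⟨x, hx, _⟩ := mem_iUnion₂.1 (ht (subset_closure hy))
    exact ⟨x, hx⟩
  obtain ⟨x0, hx0⟩ := htne
  set 𝒮 : Finset (Finset E) := t.powerset.filter fun s =>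
    s.Nonempty ∧ IsPoincareSet μ p Ω (⋃ x ∈ s, V x)
  have h𝒮 : 𝒮.Nonempty := ⟨{x0}, by
    simp only [𝒮, Finset.mem_filter, Finset.mem_powerset, Finset.singleton_subset_iff]
    exact ⟨hx0, by simp, by simpa using hPU x0 (htc x0 hx0)⟩⟩
  obtain ⟨s, hs, hmax⟩ := 𝒮.exists_max_image Finset.card h𝒮
  simp only [𝒮, Finset.mem_filter, Finset.mem_powerset] at hs hmax
  obtain ⟨hst, hsne, hsP⟩ := hs
  have hOs : ∀ s' ⊆ t, IsOpen (⋃ x ∈ s', V x) := fun s' hs' =>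
    isOpen_biUnion fun x hx => hVo x (hs' hx)
  have hdisj : ∀ j ∈ t \ s, ¬ ((⋃ x ∈ s, V x) ∩ V j).Nonempty := by
    intro j hj hne
    rw [Finset.mem_sdiff] at hj
    have hP := hsP.union hp (hPU j (htc j hj.1))
      (((hOs s hst).inter (hVo j hj.1)).measure_pos μ hne).ne' (hfin _ inter_subset_right)
    have := hmax (insert j s) ⟨Finset.insert_subset hj.1 hst, by simp, by
      rw [Finset.set_biUnion_insert, union_comm]; exact hP⟩
    rw [Finset.card_insert_of_notMem hj.2] at this
    omega
  refine hsP.mono fun y hy => ?_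
  by_contra hys
  have hcov : Ω ⊆ (⋃ x ∈ s, V x) ∪ ⋃ x ∈ t \ s, V x := by
    intro z hz
    obtain ⟨x, hx, hzx⟩ := mem_iUnion₂.1 (ht (subset_closure hz))
    by_cases hxs : x ∈ s
    · exact Or.inl (mem_iUnion₂.2 ⟨x, hxs, hzx, hz⟩)
    · exact Or.inr (mem_iUnion₂.2 ⟨x, Finset.mem_sdiff.2 ⟨hx, hxs⟩, hzx, hz⟩)
  obtain ⟨x1, hx1⟩ := hsne
  obtain ⟨y1, hy1⟩ := hVne x1 (hst hx1)
  obtain ⟨z, _, hz1, hz2⟩ := hΩc.isPreconnected _ _ (hOs s hst) (hOs _ Finset.sdiff_subset) hcov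
    ⟨y1, hy1.2, mem_iUnion₂.2 ⟨x1, hx1, hy1⟩⟩ ⟨y, hy, (hcov hy).resolve_left hys⟩
  obtain ⟨j, hj, hzj⟩ := mem_iUnion₂.1 hz2
  exact hdisj j hj ⟨z, hz1, hzj⟩

end Translation

/-! ### Interior cones of a Lipschitz domain. -/

section

/-- `Ω` satisfies the uniform interior cone condition near `x₀`, with axis `e`, aperture `κ` and
height `r`. -/
def HasConeAt (Ω : Set E3) (x₀ e : E3) (r κ : ℝ) : Prop :=
  ∀ x ∈ closure Ω ∩ Metric.ball x₀ r, ∀ s : ℝ, 0 < s → s ≤ r →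
    ∀ v : E3, ‖v - s • e‖ ≤ κ * s → x + v ∈ Ω

lemma norm_horizontal_le (v : E3) : ‖(!₂[v 0, v 1] : EuclideanSpace ℝ (Fin 2))‖ ≤ ‖v‖ := by
  rw [EuclideanSpace.norm_eq, EuclideanSpace.norm_eq]
  refine Real.sqrt_le_sqrt ?_
  simp only [Fin.sum_univ_two, Fin.sum_univ_three]
  simp
  positivity

lemma abs_coord_le (v : E3) (i : Fin 3) : |v i| ≤ ‖v‖ := by
  simpa using PiLp.norm_apply_le v i

lemma graph_le_of_mem_closure {Ω : Set E3} {x₀ : E3} {e : E3 ≃ₗᵢ[ℝ] E3}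
    {f : EuclideanSpace ℝ (Fin 2) → ℝ} (hf : Continuous f) {R : ℝ}
    (h : ∀ x ∈ Metric.ball x₀ R, x ∈ Ω ↔ f !₂[e x 0, e x 1] < e x 2) {x : E3}
    (hx : x ∈ closure Ω) (hxR : x ∈ Metric.ball x₀ R) : f !₂[e x 0, e x 1] ≤ e x 2 := by
  have h1 : x ∈ closure (Metric.ball x₀ R ∩ Ω) :=
    Metric.isOpen_ball.inter_closure ⟨hxR, hx⟩
  have hcl : IsClosed {x : E3 | f !₂[e x 0, e x 1] ≤ e x 2} := by
    refine isClosed_le (hf.comp ?_) (by fun_prop)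
    refine (PiLp.continuous_toLp 2 _).comp (continuous_pi fun i => ?_)
    fin_cases i
    · exact (EuclideanSpace.proj (𝕜 := ℝ) (0 : Fin 3)).continuous.comp e.continuous
    · exact (EuclideanSpace.proj (𝕜 := ℝ) (1 : Fin 3)).continuous.comp e.continuous
  exact closure_minimal (fun y hy => ((h y hy.1).1 hy.2).le) hcl h1

/-- The axis is the vertical of the chart. A step `v` within `κ s` of `s e` rises by at least `s - κ
s`, while the graph rises by at most `K κ s` under the horizontal displacement. -/
lemma IsLipschitzDomain.exists_hasConeAt {Ω : Set E3} (hΩ : IsLipschitzDomain Ω) {x₀ : E3}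
    (hx₀ : x₀ ∈ frontier Ω) :
    ∃ (e : E3) (r κ : ℝ), ‖e‖ = 1 ∧ 0 < r ∧ 0 < κ ∧ κ ≤ 1 ∧ HasConeAt Ω x₀ e r κ := by
  obtain ⟨e, f, K, R, hf, hR, h⟩ := hΩ.lipschitz_boundary x₀ hx₀
  have hK : (0 : ℝ) ≤ K := K.2
  -- Chosen so that `κ (K + 1) = 1/2`: the net height gained over the graph is at least `s / 2 > 0`.
  set κ : ℝ := 1 / (2 * (K + 1)) with hκ
  have hκ0 : 0 < κ := by positivity
  have hκ1 : κ * (K + 1) = 1 / 2 := by rw [hκ]; field_simp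
  have hκ2 : κ ≤ 1 := by nlinarith
  set E : E3 := EuclideanSpace.single 2 1 with hE
  have hEn : ‖e.symm E‖ = 1 := by simp [hE]
  -- A third of the chart radius: `|x - x₀| < R/3` and `|v| ≤ (1 + κ) s ≤ 2R/3` keep `x + v` in the
  -- chart.
  refine ⟨e.symm E, R / 3, κ, hEn, by positivity, hκ0, hκ2, ?_⟩
  rintro x ⟨hx, hxr⟩ s hs hsr v hv
  have hxR : x ∈ Metric.ball x₀ R := Metric.ball_subset_ball (by linarith) hxr
  have h1 := graph_le_of_mem_closure hf.continuous h hx hxR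
  have hw : ‖e v - s • E‖ ≤ κ * s := by
    have : e v - s • E = e (v - s • e.symm E) := by simp
    rw [this, e.norm_map]
    exact hv
  have hw2 : |e v 2 - s| ≤ κ * s := by
    have := (abs_coord_le (e v - s • E) 2).trans hw
    simpa [hE] using this
  have hwh : ‖(!₂[e v 0, e v 1] : EuclideanSpace ℝ (Fin 2))‖ ≤ κ * s := by
    have := (norm_horizontal_le (e v - s • E)).trans hw
    simpa [hE] using this
  have hvn : ‖v‖ ≤ κ * s + s := by
    have := norm_add_le (v - s • e.symm E) (s • e.symm E)
    rw [sub_add_cancel, norm_smul, hEn, Real.norm_of_nonneg hs.le, mul_one] at this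
    linarith
  have hxv : x + v ∈ Metric.ball x₀ R := by
    rw [mem_ball_iff_norm] at hxr ⊢
    have : x + v - x₀ = (x - x₀) + v := by abel
    rw [this]
    have := norm_add_le (x - x₀) v
    nlinarith
  rw [h _ hxv]
  have hLip : f !₂[e (x + v) 0, e (x + v) 1] ≤ f !₂[e x 0, e x 1] + K * (κ * s) := by
    have h2 := hf.dist_le_mul !₂[e (x + v) 0, e (x + v) 1] !₂[e x 0, e x 1]
    rw [Real.dist_eq, dist_eq_norm] at h2
    have h3 : (!₂[e (x + v) 0, e (x + v) 1] - !₂[e x 0, e x 1] : EuclideanSpace ℝ (Fin 2)) =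
        !₂[e v 0, e v 1] := by
      ext i; fin_cases i <;> simp
    rw [h3] at h2
    have := (le_abs_self _).trans (h2.trans (mul_le_mul_of_nonneg_left hwh hK))
    linarith
  have h4 : e (x + v) 2 = e x 2 + e v 2 := by simp
  rw [h4]
  have h5 := (abs_le.1 hw2).1
  have : κ * s * (K + 1) = s / 2 := by
    rw [mul_right_comm, hκ1]; ring
  nlinarith

variable {Ω : Set E3} {p : ℝ≥0∞} [Fact (1 ≤ p)]

/-- The cone at `x₀` contains the ball of radius `κ r` about `x₀ + r e`. Translation by `r e` moves
the neighbourhood of `x₀` into that ball, along cone axes that stay in `Ω`. -/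
lemma HasConeAt.isPoincareSet (hp : p ≠ ⊤) (hΩ : IsOpen Ω) {x₀ e : E3} {r κ : ℝ}
    (hr : 0 < r) (hκ : 0 < κ) (hκ1 : κ ≤ 1) (h : HasConeAt Ω x₀ e r κ) (hx₀ : x₀ ∈ closure Ω) :
    IsPoincareSet volume p Ω (Metric.ball x₀ (κ * r) ∩ Ω) := by
  have hκr : κ * r ≤ r := mul_le_of_le_one_left hr.le hκ1
  have hball : Metric.ball (x₀ + r • e) (κ * r) ⊆ Ω := by
    intro y hy
    have := h x₀ ⟨hx₀, Metric.mem_ball_self hr⟩ r hr le_rfl (y - x₀) (by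
      rw [mem_ball_iff_norm, ← sub_sub] at hy
      exact hy.le)
    rwa [add_sub_cancel] at this
  refine isPoincareSet_of_translate hp (z := r • e)
    (Metric.isOpen_ball.measurableSet.inter hΩ.measurableSet) hΩ.measurableSet
    Metric.isOpen_ball.measurableSet ((isPoincareSet_ball hp _ (by positivity)).mono_domain hball)
    (fun x hx => ?_) fun x hx t ht => ?_
  · have := hx.1
    rw [mem_ball_iff_norm] at this ⊢
    rwa [add_sub_add_right_eq_sub]
  · refine h x ⟨subset_closure hx.2, Metric.ball_subset_ball hκr hx.1⟩ (t * r)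
      (mul_pos ht.1 hr) (mul_le_of_le_one_left hr.le ht.2) _ ?_
    rw [smul_smul, sub_self, norm_zero]
    have := ht.1
    positivity

theorem IsLipschitzDomain.isPoincareSet (hΩ : IsLipschitzDomain Ω) (hp : p ≠ ⊤) :
    IsPoincareSet volume p Ω Ω := by
  refine isPoincareSet_of_local hp hΩ.isOpen hΩ.isConnected hΩ.isBounded fun x hx => ?_
  by_cases hxΩ : x ∈ Ω
  · obtain ⟨ε, hε, hb⟩ := Metric.isOpen_iff.1 hΩ.isOpen x hxΩ
    exact ⟨Metric.ball x ε, Metric.isOpen_ball, Metric.mem_ball_self hε,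
      ((isPoincareSet_ball hp x hε).mono_domain hb).mono inter_subset_left⟩
  · have hxf : x ∈ frontier Ω := by
      rw [hΩ.isOpen.frontier_eq]
      exact ⟨hx, hxΩ⟩
    obtain ⟨e, r, κ, _, hr, hκ, hκ1, h⟩ := hΩ.exists_hasConeAt hxf
    exact ⟨_, Metric.isOpen_ball, Metric.mem_ball_self (by positivity),
      h.isPoincareSet hp hΩ.isOpen hr hκ hκ1 hx⟩

end

/-! ### The trace inequality for smooth functions. -/

section

lemma euclideanHausdorffMeasure_image_le {X Y : Type*} [MetricSpace X] [MeasurableSpace X]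
    [BorelSpace X] [MetricSpace Y] [MeasurableSpace Y] [BorelSpace Y] {g : X → Y} {K : ℝ≥0}
    (hg : LipschitzWith K g) (d : ℕ) (s : Set X) :
    μHE[d] (g '' s) ≤ (K : ℝ≥0∞) ^ d * μHE[d] s := by
  have h := hg.hausdorffMeasure_image_le (d := d) (Nat.cast_nonneg d) s
  rw [Measure.euclideanHausdorffMeasure_def, Measure.euclideanHausdorffMeasure_def]
  simp only [Measure.smul_apply, ENNReal.smul_def, smul_eq_mul, ENNReal.rpow_natCast] at h ⊢
  rw [mul_left_comm]
  gcongr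

/-- This takes the place of the area formula: surface measure on a Lipschitz image is dominated by
`K^d` times the pushed-forward Lebesgue measure, and only an upper bound is needed. -/
lemma setLIntegral_euclideanHausdorff_le {d : ℕ} {Y : Type*} [MetricSpace Y] [MeasurableSpace Y]
    [BorelSpace Y] {g : EuclideanSpace ℝ (Fin d) → Y} {K : ℝ≥0} (hg : LipschitzWith K g)
    {Γ : Set Y} (hΓ : Γ ⊆ range g) {F : Y → ℝ≥0∞} (hF : Measurable F) :
    ∫⁻ x in Γ, F x ∂μHE[d] ≤ (K : ℝ≥0∞) ^ d * ∫⁻ y in g ⁻¹' Γ, F (g y) := by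
  have hgm : Measurable g := hg.continuous.measurable
  have hle : (μHE[d] : Measure Y).restrict Γ ≤
      (K : ℝ≥0∞) ^ d • (volume.restrict (g ⁻¹' Γ)).map g := by
    refine Measure.le_iff.2 fun A hA => ?_
    rw [Measure.restrict_apply hA, Measure.smul_apply, Measure.map_apply hgm hA,
      Measure.restrict_apply (hgm hA), ← preimage_inter, smul_eq_mul]
    have h1 : A ∩ Γ = g '' (g ⁻¹' (A ∩ Γ)) :=
      (image_preimage_eq_of_subset (inter_subset_right.trans hΓ)).symm
    conv_lhs => rw [h1]
    refine (euclideanHausdorffMeasure_image_le hg d _).trans_eq ?_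
    rw [EuclideanSpace.euclideanHausdorffMeasure_eq_volume]
  refine (lintegral_mono' hle le_rfl).trans_eq ?_
  rw [lintegral_smul_measure, lintegral_map hF hgm, smul_eq_mul]

/-- The linear coordinates `(y, t) ↦ e⁻¹ (y₀, y₁, r t)` of `ℝ³`. -/
def graphCoord (e : E3 ≃ₗᵢ[ℝ] E3) {r : ℝ} (hr : r ≠ 0) :
    (EuclideanSpace ℝ (Fin 2) × ℝ) ≃L[ℝ] E3 :=
  LinearEquiv.toContinuousLinearEquiv
    { toFun := fun q => e.symm !₂[q.1 0, q.1 1, r * q.2]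
      invFun := fun x => (!₂[e x 0, e x 1], e x 2 / r)
      map_add' := fun q q' => by
        rw [← map_add]; congr 1
        ext i; fin_cases i <;> simp [mul_add]
      map_smul' := fun c q => by
        rw [RingHom.id_apply, ← map_smul]; congr 1
        ext i; fin_cases i <;> simp [mul_left_comm]
      left_inv := fun q => by
        refine Prod.ext ?_ ?_
        · ext i; fin_cases i <;> simp
        · simp [hr]
      right_inv := fun x => by
        rw [e.symm_apply_eq]
        ext i; fin_cases i <;> simp
        field_simp }

lemma graphCoord_apply (e : E3 ≃ₗᵢ[ℝ] E3) {r : ℝ} (hr : r ≠ 0)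
    (q : EuclideanSpace ℝ (Fin 2) × ℝ) :
    graphCoord e hr q = e.symm !₂[q.1 0, q.1 1, r * q.2] := rfl

/-- A linear isomorphism carries Lebesgue measure to a Haar measure, hence to a multiple of volume;
the value of the multiple is irrelevant. -/
lemma exists_lintegral_graphCoord (e : E3 ≃ₗᵢ[ℝ] E3) {r : ℝ} (hr : r ≠ 0) :
    ∃ c : ℝ≥0, ∀ F : E3 → ℝ≥0∞, Measurable F →
      ∫⁻ y, ∫⁻ t : ℝ, F (graphCoord e hr (y, t)) = c * ∫⁻ x, F x := by
  set P := graphCoord e hr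
  have hP : Measurable P := P.continuous.measurable
  set ν : Measure E3 := (volume : Measure (EuclideanSpace ℝ (Fin 2) × ℝ)).map P
  have : (volume : Measure (EuclideanSpace ℝ (Fin 2) × ℝ)).IsAddHaarMeasure := by
    rw [Measure.volume_eq_prod]
    infer_instance
  have : ν.IsAddHaarMeasure := P.isAddHaarMeasure_map volume
  refine ⟨ν.addHaarScalarFactor volume, fun F hF => ?_⟩
  have h1 : ∫⁻ x, F x ∂ν = ν.addHaarScalarFactor volume * ∫⁻ x, F x := by
    conv_lhs => rw [Measure.isAddLeftInvariant_eq_smul ν volume]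
    rw [lintegral_smul_measure]
    rfl
  rw [← h1, lintegral_map hF hP, Measure.volume_eq_prod, lintegral_prod]
  exact (hF.comp hP).aemeasurable

/-- A piece `Γ` of the boundary of `Ω` on which smooth functions satisfy the trace inequality. -/
def IsTraceSet (Ω : Set E3) (r : ℝ) (Γ : Set E3) : Prop :=
  ∃ C : ℝ≥0, ∀ φ : E3 → ℝ, ContDiff ℝ ∞ φ →
    ∫⁻ x in Γ, ‖φ x‖ₑ ^ r ∂μHE[2] ≤
      C * ((∫⁻ x in Ω, ‖φ x‖ₑ ^ r) + ∫⁻ x in Ω, ‖fderiv ℝ φ x‖ₑ ^ r)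

/-- `hD` says that the segments from `Γ` in direction `z` sweep out `Ω` with bounded density. The
value `φ(x)` is compared with `φ(x + a z)`, the comparison is averaged over `a ∈ (0, 1]`, and the
result is integrated over `Γ`. -/
lemma isTraceSet_of_transversal {Ω Γ : Set E3} {z : E3} {D : ℝ≥0}
    (hD : ∀ F : E3 → ℝ≥0∞, Measurable F →
      ∫⁻ x in Γ, (∫⁻ t in Ioc (0 : ℝ) 1, F (x + t • z)) ∂μHE[2] ≤ D * ∫⁻ x in Ω, F x)
    {r : ℝ} (hr : 1 ≤ r) : IsTraceSet Ω r Γ := by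
  have hr0 : 0 ≤ r := by linarith
  set M : ℝ≥0∞ := 2 ^ (r - 1) * (1 + ‖z‖ₑ ^ r) * D
  have hM : M ≠ ⊤ := by
    refine ENNReal.mul_ne_top (ENNReal.mul_ne_top ?_ ?_) ENNReal.coe_ne_top
    · exact ENNReal.rpow_ne_top_of_nonneg (by linarith) (by simp)
    · exact ENNReal.add_ne_top.2 ⟨ENNReal.one_ne_top, ENNReal.rpow_ne_top_of_nonneg hr0 (by simp)⟩
  refine ⟨M.toNNReal, fun φ hφ => ?_⟩
  rw [ENNReal.coe_toNNReal hM]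
  have hφm : Measurable fun x => ‖φ x‖ₑ ^ r := hφ.continuous.enorm.measurable.pow_const _
  have hdm : Measurable fun x => ‖fderiv ℝ φ x‖ₑ ^ r :=
    (hφ.continuous_fderiv (by simp)).enorm.measurable.pow_const _
  set I : (E3 → ℝ≥0∞) → E3 → ℝ≥0∞ := fun F x => ∫⁻ t in Ioc (0 : ℝ) 1, F (x + t • z) with hI
  have hIm : ∀ F, Measurable F → Measurable (I F) := fun F hF =>
    (hF.comp (by fun_prop : Measurable fun q : E3 × ℝ => q.1 + q.2 • z)).lintegral_prod_right'
  have hpt : ∀ x, ‖φ x‖ₑ ^ r ≤ 2 ^ (r - 1) *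
      (I (fun x => ‖φ x‖ₑ ^ r) x + ‖z‖ₑ ^ r * I (fun x => ‖fderiv ℝ φ x‖ₑ ^ r) x) := by
    intro x
    have h1 : ∀ a ∈ Ioc (0 : ℝ) 1, ‖φ x‖ₑ ^ r ≤ 2 ^ (r - 1) *
        (‖φ (x + a • z)‖ₑ ^ r + ‖z‖ₑ ^ r * I (fun x => ‖fderiv ℝ φ x‖ₑ ^ r) x) := by
      intro a ha
      have e : φ x = φ (x + a • z) - (φ (x + a • z) - φ x) := by ring
      calc ‖φ x‖ₑ ^ r ≤ (‖φ (x + a • z)‖ₑ + ‖φ (x + a • z) - φ x‖ₑ) ^ r := by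
            refine ENNReal.rpow_le_rpow ?_ hr0
            conv_lhs => rw [e]
            exact enorm_sub_le
        _ ≤ _ := ENNReal.rpow_add_le_mul_rpow_add_rpow _ _ hr
        _ ≤ _ := by
            gcongr
            exact enorm_sub_smul_rpow_le hφ x z (Ioc_subset_Icc_self ha) hr
    calc ‖φ x‖ₑ ^ r = ∫⁻ _ in Ioc (0 : ℝ) 1, ‖φ x‖ₑ ^ r := by simp
      _ ≤ ∫⁻ a in Ioc (0 : ℝ) 1, 2 ^ (r - 1) *
          (‖φ (x + a • z)‖ₑ ^ r + ‖z‖ₑ ^ r * I (fun x => ‖fderiv ℝ φ x‖ₑ ^ r) x) :=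
        setLIntegral_mono' measurableSet_Ioc h1
      _ = _ := by
        have hm : Measurable fun a : ℝ => ‖φ (x + a • z)‖ₑ ^ r :=
          hφm.comp (by fun_prop : Measurable fun a : ℝ => x + a • z)
        rw [lintegral_const_mul _ (hm.add_const _), lintegral_add_left hm, lintegral_const]
        simp [hI]
  calc ∫⁻ x in Γ, ‖φ x‖ₑ ^ r ∂μHE[2]
      ≤ ∫⁻ x in Γ, 2 ^ (r - 1) * (I (fun x => ‖φ x‖ₑ ^ r) x +
          ‖z‖ₑ ^ r * I (fun x => ‖fderiv ℝ φ x‖ₑ ^ r) x) ∂μHE[2] := lintegral_mono hpt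
    _ = 2 ^ (r - 1) * ((∫⁻ x in Γ, I (fun x => ‖φ x‖ₑ ^ r) x ∂μHE[2]) +
          ‖z‖ₑ ^ r * ∫⁻ x in Γ, I (fun x => ‖fderiv ℝ φ x‖ₑ ^ r) x ∂μHE[2]) := by
        rw [lintegral_const_mul, lintegral_add_left (hIm _ hφm), lintegral_const_mul _ (hIm _ hdm)]
        exact (hIm _ hφm).add ((hIm _ hdm).const_mul _)
    _ ≤ 2 ^ (r - 1) * (D * (∫⁻ x in Ω, ‖φ x‖ₑ ^ r) +
          ‖z‖ₑ ^ r * (D * ∫⁻ x in Ω, ‖fderiv ℝ φ x‖ₑ ^ r)) := by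
        gcongr
        · exact hD _ hφm
        · exact hD _ hdm
    _ ≤ _ := by
        set A := ∫⁻ x in Ω, ‖φ x‖ₑ ^ r
        set B := ∫⁻ x in Ω, ‖fderiv ℝ φ x‖ₑ ^ r
        -- `M` is larger than necessary; the surplus is the nonnegative second summand.
        have : M * (A + B) = 2 ^ (r - 1) * (D * A + ‖z‖ₑ ^ r * (D * B)) +
            2 ^ (r - 1) * (‖z‖ₑ ^ r * (D * A) + D * B) := by ring
        rw [this]
        exact le_self_add

/-- In graph coordinates the segment from the boundary point over `y` is `t ↦ P (y, f y / r + t)`.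
Translation invariance in `t` removes the shift `f y / r`, so Tonelli bounds the swept integral by a
volume integral over `Ω`. -/
lemma IsLipschitzDomain.exists_isTraceSet {Ω : Set E3} (hΩ : IsLipschitzDomain Ω) {x₀ : E3}
    (hx₀ : x₀ ∈ frontier Ω) {ρ : ℝ} (hρ : 1 ≤ ρ) :
    ∃ ε > 0, IsTraceSet Ω ρ (frontier Ω ∩ Metric.ball x₀ ε) := by
  obtain ⟨e, f, K, R, hf, hR, h⟩ := hΩ.lipschitz_boundary x₀ hx₀
  -- Half the chart radius for the base point, and half for the vertical step `z`, whose length is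
  -- `r`.
  set r := R / 2 with hr
  have hr0 : 0 < r := by positivity
  set Γ := frontier Ω ∩ Metric.ball x₀ r with hΓ
  have hΓm : MeasurableSet Γ := isClosed_frontier.measurableSet.inter
    Metric.isOpen_ball.measurableSet
  set P := graphCoord e hr0.ne' with hP
  set z : E3 := P (0, 1) with hz
  set g : EuclideanSpace ℝ (Fin 2) → E3 := fun y => P (y, f y / r) with hg
  have hzn : ‖z‖ = r := by
    rw [hz, hP, graphCoord_apply, e.symm.norm_map, EuclideanSpace.norm_eq]
    simp [Fin.sum_univ_three, Real.sqrt_sq hr0.le]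
  obtain ⟨L, hL⟩ : ∃ L : ℝ≥0, LipschitzWith L g := by
    have h1 : LipschitzWith (‖r⁻¹‖₊ * K) fun y => f y / r := by
      have := ((lipschitzWith_smul (r⁻¹ : ℝ)).comp hf :
        LipschitzWith (‖r⁻¹‖₊ * K) ((fun t : ℝ => r⁻¹ • t) ∘ f))
      have e : (fun y => f y / r) = (fun t : ℝ => r⁻¹ • t) ∘ f := by
        ext y
        simp [div_eq_inv_mul]
      rwa [e]
    exact ⟨_, P.lipschitz.comp (LipschitzWith.id.prodMk h1)⟩
  have hex : ∀ x ∈ Γ, f !₂[e x 0, e x 1] = e x 2 := by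
    rintro x ⟨hxf, hxr⟩
    have hxR : x ∈ Metric.ball x₀ R := Metric.ball_subset_ball (by linarith) hxr
    refine le_antisymm (graph_le_of_mem_closure hf.continuous h (frontier_subset_closure hxf) hxR)
      (not_lt.1 fun hlt => ?_)
    rw [hΩ.isOpen.frontier_eq] at hxf
    exact hxf.2 ((h x hxR).2 hlt)
  have hΓg : Γ ⊆ range g := by
    intro x hx
    refine ⟨!₂[e x 0, e x 1], ?_⟩
    change P _ = x
    rw [hP, graphCoord_apply, e.symm_apply_eq, hex x hx]
    ext i; fin_cases i <;> simp
    field_simp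
  have hflow : ∀ x ∈ Γ, ∀ t ∈ Ioc (0 : ℝ) 1, x + t • z ∈ Ω := by
    intro x hx t ht
    have hxt : x + t • z ∈ Metric.ball x₀ R := by
      have h1 := hx.2
      rw [mem_ball_iff_norm] at h1 ⊢
      have h2 : x + t • z - x₀ = (x - x₀) + t • z := by abel
      rw [h2]
      have h3 := norm_add_le (x - x₀) (t • z)
      rw [norm_smul, hzn, Real.norm_of_nonneg ht.1.le] at h3
      nlinarith [ht.2]
    rw [h _ hxt]
    have h4 : ∀ i, e (x + t • z) i = e x i + t * (!₂[0, 0, r] : E3) i := by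
      intro i
      have : e z = !₂[0, 0, r] := by
        rw [hz, hP, graphCoord_apply, e.apply_symm_apply]
        simp
      rw [map_add, map_smul, this]
      rfl
    rw [h4, h4, h4]
    simp only [Matrix.cons_val_zero, Matrix.cons_val_one, mul_zero, add_zero,
      Matrix.cons_val]
    rw [hex x hx]
    have := mul_pos ht.1 hr0
    linarith
  obtain ⟨c, hc⟩ := exists_lintegral_graphCoord e hr0.ne'
  refine ⟨r, hr0, isTraceSet_of_transversal (z := z) (D := L ^ 2 * c) (fun F hF => ?_) hρ⟩
  have hFm : Measurable fun x => ∫⁻ t in Ioc (0 : ℝ) 1, F (x + t • z) :=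
    (hF.comp (by fun_prop : Measurable fun q : E3 × ℝ => q.1 + q.2 • z)).lintegral_prod_right'
  refine (setLIntegral_euclideanHausdorff_le hL hΓg hFm).trans ?_
  push_cast
  rw [mul_assoc]
  gcongr
  rw [← lintegral_indicator hΩ.isOpen.measurableSet, ← hc _ (hF.indicator hΩ.isOpen.measurableSet)]
  refine (setLIntegral_mono' (hL.continuous.measurable hΓm) fun y hy => ?_).trans
    (setLIntegral_le_lintegral _ _)
  have hgz : ∀ t : ℝ, g y + t • z = P (y, f y / r + t) := by
    intro t
    rw [hg, hz, ← map_smul, ← map_add]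
    simp
  calc ∫⁻ t in Ioc (0 : ℝ) 1, F (g y + t • z)
      ≤ ∫⁻ t in Ioc (0 : ℝ) 1, Ω.indicator F (P (y, f y / r + t)) := by
        refine setLIntegral_mono' measurableSet_Ioc fun t ht => ?_
        rw [← hgz, indicator_of_mem (hflow _ hy t ht)]
    _ ≤ ∫⁻ t : ℝ, Ω.indicator F (P (y, f y / r + t)) := setLIntegral_le_lintegral _ _
    _ = _ := lintegral_add_left_eq_self (fun t => Ω.indicator F (P (y, t))) (f y / r)

lemma IsLipschitzDomain.isTraceSet {Ω : Set E3} (hΩ : IsLipschitzDomain Ω) {ρ : ℝ}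
    (hρ : 1 ≤ ρ) : IsTraceSet Ω ρ (frontier Ω) := by
  have hK : IsCompact (frontier Ω) :=
    Metric.isCompact_of_isClosed_isBounded isClosed_frontier
      (hΩ.isBounded.closure.subset frontier_subset_closure)
  refine hK.induction_on (p := IsTraceSet Ω ρ) ⟨0, fun φ _ => by simp⟩ ?_ ?_ fun x hx => ?_
  · rintro s t hst ⟨C, hC⟩
    exact ⟨C, fun φ hφ => (lintegral_mono_set hst).trans (hC φ hφ)⟩
  · rintro s t ⟨C, hC⟩ ⟨D, hD⟩
    refine ⟨C + D, fun φ hφ => ?_⟩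
    push_cast
    rw [add_mul]
    exact (lintegral_union_le _ _ _).trans (add_le_add (hC φ hφ) (hD φ hφ))
  · obtain ⟨ε, hε, h⟩ := hΩ.exists_isTraceSet hx hρ
    exact ⟨_, inter_mem_nhdsWithin _ (Metric.ball_mem_nhds x hε), h⟩

variable {Ω : Set E3} {p : ℝ≥0∞} [Fact (1 ≤ p)]

/-- The trace inequality for smooth functions on a Lipschitz domain. -/
theorem IsLipschitzDomain.exists_trace_bound (hΩ : IsLipschitzDomain Ω) (hp : p ≠ ⊤) :
    ∃ C : ℝ≥0, ∀ φ : E3 → ℝ, ContDiff ℝ ∞ φ → eLpNorm φ p (areaOn Ω) ≤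
      C * (eLpNorm φ p (volOn Ω) + eLpNorm (fderiv ℝ φ) p (volOn Ω)) := by
  have hp0 : p ≠ 0 := (lt_of_lt_of_le zero_lt_one Fact.out).ne'
  have hr1 := one_le_toReal hp
  have hr : 0 < p.toReal := by linarith
  obtain ⟨C, hC⟩ := hΩ.isTraceSet hr1
  refine ⟨C ^ (1 / p.toReal), fun φ hφ => ?_⟩
  rw [← ENNReal.rpow_le_rpow_iff hr, eLpNorm_rpow hp0 hp, ENNReal.mul_rpow_of_nonneg _ _ hr.le,
    ← ENNReal.coe_rpow_of_nonneg _ hr.le, ← NNReal.rpow_mul, one_div,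
    inv_mul_cancel₀ hr.ne', NNReal.rpow_one]
  refine (hC φ hφ).trans ?_
  gcongr
  rw [← eLpNorm_rpow hp0 hp, ← eLpNorm_rpow hp0 hp]
  exact ENNReal.add_rpow_le_rpow_add _ _ hr1

end

/-! ### Mollification and local smooth approximation. -/

section

section Mollify

variable {E : Type*} [NormedAddCommGroup E] [NormedSpace ℝ E] [MeasurableSpace E] [BorelSpace E]
  [FiniteDimensional ℝ E] {μ : Measure E} [μ.IsAddHaarMeasure]
  {F : Type*} [NormedAddCommGroup F] {p : ℝ≥0∞} [Fact (1 ≤ p)]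

/-- For `p < ∞`, composition with a continuously varying family of measure-preserving maps is
continuous in `L^p`; this is read off at `s = 0`. -/
lemma exists_translate_eLpNorm_le (hp : p ≠ ⊤) {f : E → F} (hf : MemLp f p μ) {ε : ℝ≥0∞}
    (hε : 0 < ε) : ∃ δ > 0, ∀ s : E, ‖s‖ < δ → eLpNorm (fun x => f (x - s) - f x) p μ ≤ ε := by
  have hmp : ∀ s : E, MeasurePreserving (fun x : E => x - s) μ μ := fun s =>
    measurePreserving_sub_right μ s
  let g : C(E, C(E, E)) := ContinuousMap.curry ⟨fun q : E × E => q.2 - q.1, by fun_prop⟩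
  have hg : Continuous fun s => g s := g.continuous
  have hc := (continuous_const (y := hf.toLp f)).compMeasurePreservingLp hg
    (fun s => hmp s) hp
  have h0 := hc.tendsto 0
  rw [EMetric.tendsto_nhds_nhds] at h0
  obtain ⟨η, hη, hs⟩ := h0 ε hε
  obtain ⟨δ, hδ, hδη⟩ : ∃ δ : ℝ, 0 < δ ∧ ENNReal.ofReal δ ≤ η := by
    rcases eq_or_ne η ⊤ with rfl | hη'
    · exact ⟨1, one_pos, le_top⟩
    · exact ⟨η.toReal, ENNReal.toReal_pos hη.ne' hη', ENNReal.ofReal_toReal_le⟩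
  refine ⟨δ, hδ, fun s hsδ => ?_⟩
  have h1 := (hs (x := s) (by
    rw [edist_zero_right, ← ofReal_norm]
    exact ((ENNReal.ofReal_lt_ofReal_iff hδ).2 hsδ).trans_le hδη)).le
  rw [Lp.edist_def] at h1
  refine le_trans (le_of_eq (eLpNorm_congr_ae ?_)) h1
  have e1 := Lp.coeFn_compMeasurePreserving (hf.toLp f) (hmp s)
  have e2 := Lp.coeFn_compMeasurePreserving (hf.toLp f) (hmp 0)
  have e3 := (hmp s).quasiMeasurePreserving.ae_eq_comp hf.coeFn_toLp
  have e4 := (hmp 0).quasiMeasurePreserving.ae_eq_comp hf.coeFn_toLp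
  filter_upwards [e1, e2, e3, e4] with x h1 h2 h3 h4
  have h1' : (Lp.compMeasurePreserving (g s) (hmp s) (hf.toLp f)) x =
    (hf.toLp f ∘ fun x => x - s) x := h1
  have h2' : (Lp.compMeasurePreserving (g 0) (hmp 0) (hf.toLp f)) x =
    (hf.toLp f ∘ fun x => x - 0) x := h2
  rw [Pi.sub_apply, h1', h2', h3, h4]
  simp

variable [NormedSpace ℝ F] [CompleteSpace F]

/-- The mollification of `f` by the normalized bump function `b`. -/
def mollify (μ : Measure E) {c : E} (b : ContDiffBump c) (f : E → F) : E → F :=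
  convolution (b.normed μ) f (ContinuousLinearMap.lsmul ℝ ℝ) μ

omit [BorelSpace E] [μ.IsAddHaarMeasure] [CompleteSpace F] in
lemma mollify_apply {c : E} (b : ContDiffBump c) (f : E → F) (x : E) :
    mollify μ b f x = ∫ s, b.normed μ s • f (x - s) ∂μ := rfl

omit [CompleteSpace F] in
lemma contDiff_mollify {c : E} (b : ContDiffBump c) {f : E → F} (hf : LocallyIntegrable f μ) :
    ContDiff ℝ ∞ (mollify μ b f) :=
  b.hasCompactSupport_normed.contDiff_convolution_left _ b.contDiff_normed hf

/-- The normalized bump is a probability density, so by Jensen and Tonelli the `p`-th power of the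
mollification error is at most an average of those of the translation errors. -/
lemma eLpNorm_mollify_sub_le (hp : p ≠ ⊤) {c : E} (b : ContDiffBump c) {f : E → F}
    (hfm : StronglyMeasurable f) (hf : MemLp f p μ) {ε : ℝ≥0∞}
    (h : ∀ s ∈ Metric.ball c b.rOut, eLpNorm (fun x => f (x - s) - f x) p μ ≤ ε) :
    eLpNorm (fun x => mollify μ b f x - f x) p μ ≤ ε := by
  have hp0 : p ≠ 0 := (lt_of_lt_of_le zero_lt_one Fact.out).ne'
  have hr1 := one_le_toReal hp
  set r := p.toReal
  have hr : 0 < r := by linarith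
  set ρ : E → ℝ := b.normed μ with hρ
  have hρm : Measurable ρ := b.continuous_normed.measurable
  have hρ0 : ∀ s, 0 ≤ ρ s := b.nonneg_normed
  set ν : Measure E := μ.withDensity fun s => ENNReal.ofReal (ρ s) with hν
  have : IsProbabilityMeasure ν := ⟨by
    rw [hν, withDensity_apply _ MeasurableSet.univ, Measure.restrict_univ,
      ← ofReal_integral_eq_lintegral_ofReal b.integrable_normed (ae_of_all _ hρ0),
      b.integral_normed, ENNReal.ofReal_one]⟩
  have hloc : LocallyIntegrable f μ := hf.locallyIntegrable Fact.out
  have hjm : StronglyMeasurable fun q : E × E => f (q.1 - q.2) - f q.1 :=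
    (hfm.comp_measurable (measurable_fst.sub measurable_snd)).sub
      (hfm.comp_measurable measurable_fst)
  have hpt : ∀ x, ‖mollify μ b f x - f x‖ₑ ^ r ≤ ∫⁻ s, ‖f (x - s) - f x‖ₑ ^ r ∂ν := by
    intro x
    have hxm : StronglyMeasurable fun s => f (x - s) - f x :=
      hjm.comp_measurable measurable_prodMk_left
    have hex : Integrable (fun s => ρ s • f (x - s)) μ :=
      (b.hasCompactSupport_normed (μ := μ)).convolutionExists_left
        (ContinuousLinearMap.lsmul ℝ ℝ : ℝ →L[ℝ] F →L[ℝ] F) b.continuous_normed hloc x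
    have e : mollify μ b f x - f x = ∫ s, ρ s • (f (x - s) - f x) ∂μ := by
      simp only [smul_sub]
      rw [integral_sub hex (b.integrable_normed.smul_const _), integral_smul_const,
        b.integral_normed, one_smul]
      rfl
    have h1 : ‖mollify μ b f x - f x‖ₑ ≤ ∫⁻ s, ‖f (x - s) - f x‖ₑ ∂ν := by
      rw [e, hν, lintegral_withDensity_eq_lintegral_mul _ hρm.ennreal_ofReal hxm.enorm]
      refine (enorm_integral_le_lintegral_enorm _).trans_eq (lintegral_congr fun s => ?_)
      rw [enorm_smul, Pi.mul_apply, ← ofReal_norm (ρ s), Real.norm_of_nonneg (hρ0 s)]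
    exact (ENNReal.rpow_le_rpow h1 hr.le).trans
      (rpow_lintegral_enorm_le hxm.aestronglyMeasurable hr1)
  rw [← ENNReal.rpow_le_rpow_iff hr, eLpNorm_rpow hp0 hp]
  calc ∫⁻ x, ‖mollify μ b f x - f x‖ₑ ^ r ∂μ
      ≤ ∫⁻ x, ∫⁻ s, ‖f (x - s) - f x‖ₑ ^ r ∂ν ∂μ := lintegral_mono hpt
    _ = ∫⁻ s, ∫⁻ x, ‖f (x - s) - f x‖ₑ ^ r ∂μ ∂ν :=
        lintegral_lintegral_swap (f := fun x s => ‖f (x - s) - f x‖ₑ ^ r)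
          (hjm.enorm.pow_const r).aemeasurable
    _ ≤ ∫⁻ _, ε ^ r ∂ν := by
        refine lintegral_mono_ae ?_
        rw [hν, ae_withDensity_iff hρm.ennreal_ofReal]
        refine ae_of_all _ fun s hs => ?_
        have hsb : s ∈ Metric.ball c b.rOut := by
          rw [← b.support_normed_eq (μ := μ)]
          intro h0
          exact hs (by rw [hρ, h0, ENNReal.ofReal_zero])
        rw [← eLpNorm_rpow hp0 hp]
        exact ENNReal.rpow_le_rpow (h s hsb) hr.le
    _ = ε ^ r := by simp

/-- The bumps need not be centred at the origin; it is enough that their supports shrink to it. This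
freedom is what permits shifting them into `Ω`. -/
lemma tendsto_mollify (hp : p ≠ ⊤) {f : E → F} (hfm : StronglyMeasurable f) (hf : MemLp f p μ)
    {c : ℕ → E} (b : ∀ n, ContDiffBump (c n)) (hc : Tendsto c atTop (𝓝 0))
    (hb : Tendsto (fun n => (b n).rOut) atTop (𝓝 0)) :
    Tendsto (fun n => eLpNorm (fun x => mollify μ (b n) f x - f x) p μ) atTop (𝓝 0) := by
  rw [ENNReal.tendsto_nhds_zero]
  intro ε hε
  obtain ⟨δ, hδ, h⟩ := exists_translate_eLpNorm_le hp hf hε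
  have h1 : Tendsto (fun n => (b n).rOut + ‖c n‖) atTop (𝓝 0) := by
    simpa using hb.add hc.norm
  filter_upwards [h1.eventually_lt_const hδ] with n hn
  refine eLpNorm_mollify_sub_le hp (b n) hfm hf fun s hs => h s ?_
  rw [mem_ball_iff_norm] at hs
  have := norm_add_le (s - c n) (c n)
  rw [sub_add_cancel] at this
  linarith

/-- The derivative falls on the bump; the substitution `y = x - s` prepares the use of `y ↦ b.normed
μ (x - y)` as a test function. -/
lemma fderiv_mollify {c : E} (b : ContDiffBump c) {f : E → ℝ} (hf : LocallyIntegrable f μ)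
    (x v : E) : fderiv ℝ (mollify μ b f) x v =
      ∫ y, f y * fderiv ℝ (b.normed μ) (x - y) v ∂μ := by
  have hb1 : ContDiff ℝ 1 (b.normed μ) := b.contDiff_normed (n := 1)
  have h := (b.hasCompactSupport_normed (μ := μ)).hasFDerivAt_convolution_left
    (ContinuousLinearMap.lsmul ℝ ℝ : ℝ →L[ℝ] ℝ →L[ℝ] ℝ) hb1 hf x
  have hint := ((b.hasCompactSupport_normed (μ := μ)).fderiv ℝ).convolutionExists_left
    ((ContinuousLinearMap.lsmul ℝ ℝ : ℝ →L[ℝ] ℝ →L[ℝ] ℝ).precompL E)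
    (hb1.continuous_fderiv one_ne_zero) hf x
  rw [mollify, h.fderiv, convolution, ContinuousLinearMap.integral_apply hint,
    ← integral_sub_left_eq_self _ μ x]
  refine integral_congr_ae (ae_of_all _ fun y => ?_)
  simp [mul_comm]

end Mollify

lemma gradient_coord (φ : E3 → ℝ) (x : E3) (i : Fin 3) :
    gradient φ x i = fderiv ℝ φ x (EuclideanSpace.single i 1) := by
  rw [← toDual_gradient, InnerProductSpace.toDual_apply_apply, EuclideanSpace.inner_single_right]
  simp

lemma norm_gradient (φ : E3 → ℝ) (x : E3) : ‖gradient φ x‖ = ‖fderiv ℝ φ x‖ :=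
  LinearIsometryEquiv.norm_map _ _

/-- Where the mollifier only looks into `Ω`, mollification commutes with the weak gradient. -/
lemma gradient_mollify {Ω : Set E3} (hΩ : MeasurableSet Ω) {u : E3 → ℝ} {G : E3 → E3}
    (h : IsWeakGradient Ω u G) (hu : LocallyIntegrable (Ω.indicator u))
    (hG : LocallyIntegrable (Ω.indicator G)) {c : E3} (b : ContDiffBump c) {x : E3}
    (hx : ∀ s ∈ Metric.closedBall c b.rOut, x - s ∈ Ω) :
    gradient (mollify volume b (Ω.indicator u)) x = mollify volume b (Ω.indicator G) x := by
  set ρ : E3 → ℝ := b.normed volume with hρ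
  have hρs : ContDiff ℝ ∞ ρ := b.contDiff_normed
  ext i
  set φ : E3 → ℝ := fun y => ρ (x - y) with hφ
  have hsub : Continuous fun y : E3 => x - y := by fun_prop
  have hφs : ContDiff ℝ ∞ φ := hρs.comp (contDiff_const.sub contDiff_id)
  have hts : tsupport φ ⊆ Ω := by
    have h1 : tsupport φ ⊆ (fun y => x - y) ⁻¹' tsupport ρ :=
      tsupport_comp_subset_preimage ρ hsub
    intro y hy
    have h2 := h1 hy
    rw [mem_preimage, hρ, b.tsupport_normed_eq] at h2
    have := hx _ h2
    rwa [sub_sub_cancel] at this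
  have hφc : HasCompactSupport φ :=
    (b.hasCompactSupport_normed (μ := volume)).comp_homeomorph (Homeomorph.subLeft x)
  have hw := h φ hφs hφc hts i
  -- This sign from the chain rule cancels the one in the definition of the weak gradient.
  have hdφ : ∀ y, fderiv ℝ φ y (EuclideanSpace.single i 1) =
      - fderiv ℝ ρ (x - y) (EuclideanSpace.single i 1) := by
    intro y
    have h1 : HasFDerivAt (fun y : E3 => x - y) (-ContinuousLinearMap.id ℝ E3) y :=
      (hasFDerivAt_id y).const_sub x
    have h2 := ((hρs.differentiable (by simp)) (x - y)).hasFDerivAt.comp y h1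
    have h3 : fderiv ℝ φ y = _ := h2.fderiv
    rw [h3]
    simp
  rw [gradient_coord, fderiv_mollify b hu]
  have e1 : ∫ y, Ω.indicator u y * fderiv ℝ ρ (x - y) (EuclideanSpace.single i 1) =
      ∫ y in Ω, G y i * φ y := by
    rw [← neg_neg (∫ y in Ω, G y i * φ y), ← hw, ← integral_neg, ← integral_indicator hΩ]
    refine integral_congr_ae (ae_of_all _ fun y => ?_)
    by_cases hy : y ∈ Ω
    · simp [hy, hdφ]
    · simp [hy]
  rw [e1, mollify_apply]
  have hint : Integrable fun s => ρ s • Ω.indicator G (x - s) :=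
    (b.hasCompactSupport_normed (μ := volume)).convolutionExists_left
      (ContinuousLinearMap.lsmul ℝ ℝ : ℝ →L[ℝ] E3 →L[ℝ] E3) b.continuous_normed hG x
  have e2 := (EuclideanSpace.proj (𝕜 := ℝ) i : E3 →L[ℝ] ℝ).integral_comp_comm hint
  refine Eq.trans ?_ e2
  rw [← integral_sub_left_eq_self _ volume x, ← integral_indicator hΩ]
  refine integral_congr_ae (ae_of_all _ fun y => ?_)
  by_cases hy : y ∈ Ω
  · simp [hy, hφ, mul_comm]
  · simp [hy]

variable {Ω : Set E3} {p : ℝ≥0∞} [Fact (1 ≤ p)]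

/-- The bump has centre `-t e` and radius `κ t`, so the convolution at `x` samples points `x - s`
with `-s` within `κ t` of `t e`, that is, in the interior cone at `x`. The jump of the extension by
zero is thus never seen near `x₀`. Away from `x₀` this fails for the gradient, but the functions
still converge on all of `Ω`. -/
lemma HasConeAt.exists_local_approx (hΩ : IsOpen Ω) (hp : p ≠ ⊤) {x₀ e : E3} {r κ : ℝ}
    (hr : 0 < r) (hκ : 0 < κ) (h : HasConeAt Ω x₀ e r κ) {u : E3 → ℝ} {G : E3 → E3}
    (hum : StronglyMeasurable u) (hGm : StronglyMeasurable G) (hu : MemLp u p (volOn Ω))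
    (hG : MemLp G p (volOn Ω)) (huG : IsWeakGradient Ω u G) :
    ∃ φ : ℕ → E3 → ℝ, (∀ n, ContDiff ℝ ∞ (φ n)) ∧
      Tendsto (fun n => eLpNorm (fun x => φ n x - u x) p (volOn Ω)) atTop (𝓝 0) ∧
      Tendsto (fun n => eLpNorm (fun x => gradient (φ n) x - G x) p
        (volume.restrict (Metric.ball x₀ r ∩ Ω))) atTop (𝓝 0) := by
  have hΩm := hΩ.measurableSet
  set t : ℕ → ℝ := fun n => r / (n + 1) with ht
  have ht0 : ∀ n, 0 < t n := fun n => by positivity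
  have htr : ∀ n, t n ≤ r := fun n => div_le_self hr.le (by linarith [n.cast_nonneg (α := ℝ)])
  have htl : Tendsto t atTop (𝓝 0) := by
    have := (tendsto_const_div_atTop_nhds_zero_nat r).comp (tendsto_add_atTop_nat 1)
    simpa [ht, Function.comp_def] using this
  set b : ∀ n, ContDiffBump (-(t n • e)) := fun n =>
    ⟨κ * t n / 2, κ * t n, by have := ht0 n; positivity, by
      have := mul_pos hκ (ht0 n); linarith⟩ with hb
  have hcl : Tendsto (fun n => -(t n • e)) atTop (𝓝 0) := by
    simpa using (htl.smul_const e).neg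
  have hbl : Tendsto (fun n => (b n).rOut) atTop (𝓝 0) := by
    simpa using htl.const_mul κ
  have hu' : MemLp (Ω.indicator u) p volume := (memLp_indicator_iff_restrict hΩm).2 hu
  have hG' : MemLp (Ω.indicator G) p volume := (memLp_indicator_iff_restrict hΩm).2 hG
  have hlu := hu'.locallyIntegrable (Fact.out : 1 ≤ p)
  have hlG := hG'.locallyIntegrable (Fact.out : 1 ≤ p)
  refine ⟨fun n => mollify volume (b n) (Ω.indicator u), fun n => contDiff_mollify _ hlu, ?_, ?_⟩
  · refine tendsto_of_tendsto_of_tendsto_of_le_of_le tendsto_const_nhds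
      (tendsto_mollify hp (hum.indicator hΩm) hu' b hcl hbl) (fun _ => zero_le) fun n => ?_
    refine le_trans (le_of_eq (eLpNorm_congr_ae ?_))
      (eLpNorm_mono_measure _ Measure.restrict_le_self)
    filter_upwards [ae_restrict_mem hΩm] with x hx
    rw [indicator_of_mem hx]
  · refine tendsto_of_tendsto_of_tendsto_of_le_of_le tendsto_const_nhds
      (tendsto_mollify hp (hGm.indicator hΩm) hG' b hcl hbl) (fun _ => zero_le) fun n => ?_
    refine le_trans (le_of_eq (eLpNorm_congr_ae ?_))
      (eLpNorm_mono_measure _ Measure.restrict_le_self)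
    filter_upwards [ae_restrict_mem (Metric.isOpen_ball.measurableSet.inter hΩm)] with x hx
    rw [indicator_of_mem hx.2, gradient_mollify hΩm huG hlu hlG]
    intro s hs
    rw [sub_eq_add_neg]
    refine h x ⟨subset_closure hx.2, hx.1⟩ (t n) (ht0 n) (htr n) _ ?_
    rw [mem_closedBall_iff_norm] at hs
    have e1 : -s - t n • e = -(s - -(t n • e)) := by abel
    rw [e1, norm_neg]
    exact hs

lemma IsLipschitzDomain.exists_hasConeAt_of_closure (hΩ : IsLipschitzDomain Ω) {x₀ : E3}
    (hx₀ : x₀ ∈ closure Ω) :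
    ∃ (e : E3) (r κ : ℝ), 0 < r ∧ 0 < κ ∧ HasConeAt Ω x₀ e r κ := by
  by_cases hx : x₀ ∈ Ω
  · obtain ⟨ε, hε, hb⟩ := Metric.isOpen_iff.1 hΩ.isOpen x₀ hx
    -- With axis `0` and aperture `1` the cone condition just asks for a ball of radius `s ≤ ε/2`
    -- about `x`.
    refine ⟨0, ε / 2, 1, by positivity, one_pos, ?_⟩
    rintro x ⟨_, hxr⟩ s hs hsr v hv
    refine hb ?_
    rw [mem_ball_iff_norm] at hxr ⊢
    rw [smul_zero, sub_zero, one_mul] at hv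
    have : x + v - x₀ = (x - x₀) + v := by abel
    rw [this]
    linarith [norm_add_le (x - x₀) v]
  · have hxf : x₀ ∈ frontier Ω := by
      rw [hΩ.isOpen.frontier_eq]
      exact ⟨hx₀, hx⟩
    obtain ⟨e, r, κ, _, hr, hκ, _, h⟩ := hΩ.exists_hasConeAt hxf
    exact ⟨e, r, κ, hr, hκ, h⟩

end

/-! ### Global smooth approximation by a partition of unity. -/

section

lemma gradient_fun_add {φ χ : E3 → ℝ} {x : E3} (hφ : DifferentiableAt ℝ φ x)
    (hχ : DifferentiableAt ℝ χ x) :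
    gradient (fun x => φ x + χ x) x = gradient φ x + gradient χ x := by
  simp only [gradient]
  rw [fderiv_fun_add hφ hχ, map_add]

lemma gradient_const_mul {φ : E3 → ℝ} {x : E3} (c : ℝ) (hφ : DifferentiableAt ℝ φ x) :
    gradient (fun x => c * φ x) x = c • gradient φ x := by
  simp only [gradient]
  rw [fderiv_const_mul hφ, map_smul]

lemma gradient_fun_sub {φ χ : E3 → ℝ} {x : E3} (hφ : DifferentiableAt ℝ φ x)
    (hχ : DifferentiableAt ℝ χ x) :
    gradient (fun x => φ x - χ x) x = gradient φ x - gradient χ x := by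
  simp only [gradient]
  rw [fderiv_fun_sub hφ hχ, map_sub]

lemma gradient_fun_mul {φ χ : E3 → ℝ} {x : E3} (hφ : DifferentiableAt ℝ φ x)
    (hχ : DifferentiableAt ℝ χ x) :
    gradient (fun x => φ x * χ x) x = φ x • gradient χ x + χ x • gradient φ x := by
  simp only [gradient]
  rw [fderiv_fun_mul hφ hχ, map_add, map_smul, map_smul]

lemma gradient_sum {ι : Type*} {s : Finset ι} {φ : ι → E3 → ℝ} {x : E3}
    (hφ : ∀ i ∈ s, DifferentiableAt ℝ (φ i) x) :
    gradient (fun x => ∑ i ∈ s, φ i x) x = ∑ i ∈ s, gradient (φ i) x := by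
  simp only [gradient]
  rw [fderiv_fun_sum hφ, map_sum]

lemma continuous_gradient {φ : E3 → ℝ} (hφ : ContDiff ℝ ∞ φ) : Continuous (gradient φ) :=
  (LinearIsometryEquiv.continuous _).comp (hφ.continuous_fderiv (by simp))

lemma eLpNorm_fderiv_eq (φ : E3 → ℝ) (p : ℝ≥0∞) (ν : Measure E3) :
    eLpNorm (fderiv ℝ φ) p ν = eLpNorm (gradient φ) p ν :=
  eLpNorm_congr_norm_ae (ae_of_all _ fun x => (norm_gradient φ x).symm)

lemma exists_smooth_partition {K : Set E3} (hK : IsCompact K) {r : E3 → ℝ}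
    (hr : ∀ x ∈ K, 0 < r x) :
    ∃ (t : Finset E3) (ζ : E3 → E3 → ℝ), (∀ i ∈ t, i ∈ K) ∧ (∀ i ∈ t, ContDiff ℝ ∞ (ζ i)) ∧
      (∀ i ∈ t, tsupport (ζ i) ⊆ Metric.ball i (r i)) ∧ (∀ i ∈ t, ∀ x, ‖ζ i x‖ ≤ 1) ∧
      ∀ x ∈ K, ∑ i ∈ t, ζ i x = 1 := by
  obtain ⟨t, htK, ht⟩ := hK.elim_nhds_subcover (fun x => Metric.ball x (r x))
    fun x hx => Metric.ball_mem_nhds x (hr x hx)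
  obtain ⟨f, hf⟩ := SmoothPartitionOfUnity.exists_isSubordinate (ι := t)
    (modelWithCornersSelf ℝ E3) hK.isClosed
    (fun i => Metric.ball (i : E3) (r i)) (fun _ => Metric.isOpen_ball) (by
      intro x hx
      obtain ⟨i, hi, hxi⟩ := mem_iUnion₂.1 (ht hx)
      exact mem_iUnion.2 ⟨⟨i, hi⟩, hxi⟩)
  classical
  refine ⟨t, fun i => if hi : i ∈ t then f ⟨i, hi⟩ else 0, htK, fun i hi => ?_, fun i hi => ?_,
    fun i hi x => ?_, fun x hx => ?_⟩
  · simp only [dif_pos hi]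
    exact (f ⟨i, hi⟩).contMDiff.contDiff
  · simp only [dif_pos hi]
    exact hf ⟨i, hi⟩
  · simp only [dif_pos hi]
    rw [Real.norm_of_nonneg (f.nonneg _ _)]
    exact f.le_one _ _
  · rw [← Finset.sum_attach]
    have := f.sum_eq_one hx
    rw [finsum_eq_sum_of_fintype] at this
    rw [← this, Finset.univ_eq_attach]
    exact Finset.sum_congr rfl fun i _ => by simp

variable {Ω : Set E3} {p : ℝ≥0∞} [Fact (1 ≤ p)]

/-- Functions that are smooth up to the boundary are dense in `W^{1,p}` of a Lipschitz domain. -/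
theorem IsLipschitzDomain.exists_smooth_approx (hΩ : IsLipschitzDomain Ω) (hp : p ≠ ⊤)
    {u : E3 → ℝ} {G : E3 → E3} (hum : StronglyMeasurable u) (hGm : StronglyMeasurable G)
    (hu : MemLp u p (volOn Ω)) (hG : MemLp G p (volOn Ω)) (huG : IsWeakGradient Ω u G) :
    ∃ φ : ℕ → E3 → ℝ, (∀ n, ContDiff ℝ ∞ (φ n)) ∧
      Tendsto (fun n => eLpNorm (fun x => φ n x - u x) p (volOn Ω)) atTop (𝓝 0) ∧
      Tendsto (fun n => eLpNorm (fun x => gradient (φ n) x - G x) p (volOn Ω))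
        atTop (𝓝 0) := by
  have hΩm := hΩ.isOpen.measurableSet
  choose! e r κ hr hκ hcone using fun x (hx : x ∈ closure Ω) => hΩ.exists_hasConeAt_of_closure hx
  obtain ⟨t, ζ, htK, hζs, hζB, hζ1, hsum⟩ := exists_smooth_partition hΩ.isBounded.isCompact_closure
    (r := r) hr
  choose! a ha hau haG using fun i (hi : i ∈ closure Ω) =>
    (hcone i hi).exists_local_approx hΩ.isOpen hp (hr i hi) (hκ i hi) hum hGm hu hG huG
  have hζd : ∀ i ∈ t, ∀ x, DifferentiableAt ℝ (ζ i) x := fun i hi =>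
    (hζs i hi).differentiable (by simp)
  have had : ∀ i ∈ t, ∀ n x, DifferentiableAt ℝ (a i n) x := fun i hi n =>
    (ha i (htK i hi) n).differentiable (by simp)
  have hM : ∀ i ∈ t, ∃ M : ℝ, ∀ x, ‖gradient (ζ i) x‖ ≤ M := by
    intro i hi
    have hc : HasCompactSupport (ζ i) :=
      HasCompactSupport.of_support_subset_isCompact (isCompact_closedBall i (r i))
        ((subset_tsupport _).trans ((hζB i hi).trans Metric.ball_subset_closedBall))
    obtain ⟨M, hM⟩ := (hc.fderiv ℝ).exists_bound_of_continuous
      ((hζs i hi).continuous_fderiv (by simp))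
    exact ⟨M, fun x => by rw [norm_gradient]; exact hM x⟩
  choose! M hM using hM
  -- This cancellation makes the gradient error equal to `∑ (aᵢ - u) ∇ζᵢ + ζᵢ (∇aᵢ - G)`, in which
  -- no term in `u ∇ζᵢ` is left over.
  have hgradsum : ∀ x ∈ Ω, ∑ i ∈ t, gradient (ζ i) x = 0 := by
    intro x hx
    rw [← gradient_sum fun i hi => hζd i hi x]
    have : (fun x => ∑ i ∈ t, ζ i x) =ᶠ[𝓝 x] fun _ => (1 : ℝ) := by
      filter_upwards [hΩ.isOpen.mem_nhds hx] with y hy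
      exact hsum y (subset_closure hy)
    rw [this.gradient_eq, gradient_fun_const]
  refine ⟨fun n x => ∑ i ∈ t, ζ i x * a i n x, fun n => ContDiff.sum fun i hi =>
    (hζs i hi).mul (ha i (htK i hi) n), ?_, ?_⟩
  · have hlim : Tendsto (fun n => ∑ i ∈ t, eLpNorm (fun x => a i n x - u x) p (volOn Ω)) atTop
        (𝓝 0) := by
      simpa using tendsto_finsetSum t fun i hi => hau i (htK i hi)
    refine tendsto_of_tendsto_of_tendsto_of_le_of_le tendsto_const_nhds hlim (fun _ => zero_le)
      fun n => ?_
    have e1 : (fun x => (∑ i ∈ t, ζ i x * a i n x) - u x) =ᵐ[volOn Ω]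
        ∑ i ∈ t, fun x => ζ i x * (a i n x - u x) := by
      filter_upwards [ae_restrict_mem hΩm] with x hx
      rw [Finset.sum_apply]
      simp only [mul_sub, Finset.sum_sub_distrib]
      rw [← Finset.sum_mul, hsum x (subset_closure hx), one_mul]
    dsimp only
    rw [eLpNorm_congr_ae e1]
    refine (eLpNorm_sum_le (fun i hi => ?_) Fact.out).trans (Finset.sum_le_sum fun i hi => ?_)
    · exact (hζs i hi).continuous.aestronglyMeasurable.mul
        ((ha i (htK i hi) n).continuous.aestronglyMeasurable.sub hum.aestronglyMeasurable)
    · refine eLpNorm_mono fun x => ?_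
      rw [norm_mul]
      exact mul_le_of_le_one_left (norm_nonneg _) (hζ1 i hi x)
  · have hlim : Tendsto (fun n => ∑ i ∈ t,
        (ENNReal.ofReal (M i) * eLpNorm (fun x => a i n x - u x) p (volOn Ω) +
          eLpNorm (fun x => gradient (a i n) x - G x) p
            (volume.restrict (Metric.ball i (r i) ∩ Ω)))) atTop (𝓝 0) := by
      have : Tendsto (fun n => ∑ i ∈ t,
        (ENNReal.ofReal (M i) * eLpNorm (fun x => a i n x - u x) p (volOn Ω) +
          eLpNorm (fun x => gradient (a i n) x - G x) p
            (volume.restrict (Metric.ball i (r i) ∩ Ω)))) atTop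
            (𝓝 (∑ i ∈ t, (ENNReal.ofReal (M i) * 0 + 0))) :=
        tendsto_finsetSum t fun i hi =>
          (ENNReal.Tendsto.const_mul (hau i (htK i hi)) (Or.inr ENNReal.ofReal_ne_top)).add
            (haG i (htK i hi))
      simpa using this
    refine tendsto_of_tendsto_of_tendsto_of_le_of_le tendsto_const_nhds hlim (fun _ => zero_le)
      fun n => ?_
    have e1 : (fun x => gradient (fun x => ∑ i ∈ t, ζ i x * a i n x) x - G x) =ᵐ[volOn Ω]
        ∑ i ∈ t, ((fun x => (a i n x - u x) • gradient (ζ i) x) +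
          fun x => ζ i x • (gradient (a i n) x - G x)) := by
      filter_upwards [ae_restrict_mem hΩm] with x hx
      rw [Finset.sum_apply, gradient_sum (φ := fun i x => ζ i x * a i n x)
        fun i hi => (hζd i hi x).mul (had i hi n x)]
      simp only [Pi.add_apply, sub_smul, smul_sub, Finset.sum_add_distrib,
        Finset.sum_sub_distrib]
      rw [← Finset.smul_sum, ← Finset.sum_smul, hgradsum x hx, hsum x (subset_closure hx),
        smul_zero, one_smul, sub_zero, ← add_sub_assoc, ← Finset.sum_add_distrib]
      congr 1
      refine Finset.sum_congr rfl fun i hi => ?_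
      rw [gradient_fun_mul (hζd i hi x) (had i hi n x), add_comm]
    dsimp only
    have hm1 : ∀ i ∈ t, AEStronglyMeasurable (fun x => (a i n x - u x) • gradient (ζ i) x)
        (volOn Ω) := fun i hi =>
      ((ha i (htK i hi) n).continuous.aestronglyMeasurable.sub hum.aestronglyMeasurable).smul
        (continuous_gradient (hζs i hi)).aestronglyMeasurable
    have hm2 : ∀ i ∈ t, AEStronglyMeasurable (fun x => ζ i x • (gradient (a i n) x - G x))
        (volOn Ω) := fun i hi =>
      (hζs i hi).continuous.aestronglyMeasurable.smul
        ((continuous_gradient (ha i (htK i hi) n)).aestronglyMeasurable.sub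
          hGm.aestronglyMeasurable)
    rw [eLpNorm_congr_ae e1]
    refine (eLpNorm_sum_le (fun i hi => (hm1 i hi).add (hm2 i hi)) Fact.out).trans
      (Finset.sum_le_sum fun i hi => ?_)
    refine (eLpNorm_add_le (hm1 i hi) (hm2 i hi) Fact.out).trans (add_le_add ?_ ?_)
    · refine eLpNorm_le_mul_eLpNorm_of_ae_le_mul (ae_of_all _ fun x => ?_) p
      rw [norm_smul, mul_comm]
      gcongr
      exact hM i hi x
    -- `ζ i` vanishes off its ball, so convergence of the gradients on that ball alone is enough.
    · have hBm : MeasurableSet (Metric.ball i (r i)) := Metric.isOpen_ball.measurableSet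
      rw [← Measure.restrict_restrict hBm, ← eLpNorm_indicator_eq_eLpNorm_restrict hBm]
      refine eLpNorm_mono fun x => ?_
      by_cases hx : x ∈ Metric.ball i (r i)
      · rw [indicator_of_mem hx, norm_smul]
        exact mul_le_of_le_one_left (norm_nonneg _) (hζ1 i hi x)
      · rw [indicator_of_notMem hx,
          image_eq_zero_of_notMem_tsupport fun h => hx (hζB i hi h), zero_smul]

end

/-! ### The trace operator and the Poincaré inequality on `Ẇ^{1,p}(Ω)`. -/

section

variable {Ω : Set E3} {p : ℝ≥0∞} [Fact (1 ≤ p)]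

lemma IsLipschitzDomain.isFiniteMeasure (hΩ : IsLipschitzDomain Ω) :
    IsFiniteMeasure (volOn Ω) :=
  ⟨by rw [Measure.restrict_apply_univ]; exact hΩ.isBounded.measure_lt_top⟩

omit [Fact (1 ≤ p)] in
lemma memLp_volOn_of_continuous (hΩ : IsLipschitzDomain Ω) {F : Type*} [NormedAddCommGroup F]
    {f : E3 → F} (hf : Continuous f) [SecondCountableTopology F] : MemLp f p (volOn Ω) := by
  have := hΩ.isFiniteMeasure
  obtain ⟨C, hC⟩ := hΩ.isBounded.isCompact_closure.exists_bound_of_continuousOn hf.continuousOn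
  refine MemLp.of_bound hf.aestronglyMeasurable C ?_
  filter_upwards [ae_restrict_mem hΩ.isOpen.measurableSet] with x hx
  exact hC x (subset_closure hx)

lemma eLpNorm_le_sub_add {α F : Type*} [MeasurableSpace α] {ν : Measure α} [NormedAddCommGroup F]
    {f g : α → F} (hf : AEStronglyMeasurable f ν) (hg : AEStronglyMeasurable g ν) :
    eLpNorm f p ν ≤ eLpNorm (fun x => f x - g x) p ν + eLpNorm g p ν := by
  have := eLpNorm_add_le (hf.sub hg) hg (Fact.out : 1 ≤ p)
  rwa [sub_add_cancel] at this

omit [Fact (1 ≤ p)] in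
lemma eLpNorm_fun_sub_comm {α F : Type*} [MeasurableSpace α] {ν : Measure α} [NormedAddCommGroup F]
    (f g : α → F) : eLpNorm (fun x => f x - g x) p ν = eLpNorm (fun x => g x - f x) p ν :=
  eLpNorm_congr_norm_ae (ae_of_all _ fun _ => norm_sub_rev _ _)

lemma eLpNorm_sub_le_sub_add {α F : Type*} [MeasurableSpace α] {ν : Measure α}
    [NormedAddCommGroup F] {f g h : α → F} (hf : AEStronglyMeasurable f ν)
    (hg : AEStronglyMeasurable g ν) (hh : AEStronglyMeasurable h ν) :
    eLpNorm (fun x => f x - h x) p ν ≤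
      eLpNorm (fun x => f x - g x) p ν + eLpNorm (fun x => h x - g x) p ν := by
  rw [eLpNorm_fun_sub_comm h g]
  have := eLpNorm_add_le (hf.sub hg) (hg.sub hh) (Fact.out : 1 ≤ p)
  rwa [sub_add_sub_cancel] at this

lemma IsTrace.add {ψ χ : WDot Ω p} {g h : Lp ℝ p (areaOn Ω)} (hg : IsTrace ψ g)
    (hh : IsTrace χ h) : IsTrace (ψ + χ) (g + h) := by
  obtain ⟨φ, hφ, h1, h2, h3⟩ := hg
  obtain ⟨η, hη, k1, k2, k3⟩ := hh
  have hφc : ∀ n (ν : Measure E3), AEStronglyMeasurable (φ n) ν := fun n ν =>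
    (hφ n).continuous.aestronglyMeasurable
  have hηc : ∀ n (ν : Measure E3), AEStronglyMeasurable (η n) ν := fun n ν =>
    (hη n).continuous.aestronglyMeasurable
  refine ⟨fun n x => φ n x + η n x, fun n => (hφ n).add (hη n), ?_, ?_, ?_⟩
  · refine tendsto_of_tendsto_of_tendsto_of_le_of_le tendsto_const_nhds
      (by simpa using h1.add k1) (fun _ => zero_le) fun n => ?_
    refine le_trans (le_of_eq (eLpNorm_congr_ae ?_)) (eLpNorm_add_le
      ((hφc n _).sub (Lp.aestronglyMeasurable ψ.toLp))
      ((hηc n _).sub (Lp.aestronglyMeasurable χ.toLp)) Fact.out)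
    filter_upwards [Lp.coeFn_add ψ.toLp χ.toLp] with x hx
    rw [map_add, hx]
    simp only [Pi.add_apply]
    ring
  · refine tendsto_of_tendsto_of_tendsto_of_le_of_le tendsto_const_nhds
      (by simpa using h2.add k2) (fun _ => zero_le) fun n => ?_
    refine le_trans (le_of_eq (eLpNorm_congr_ae ?_)) (eLpNorm_add_le
      ((continuous_gradient (hφ n)).aestronglyMeasurable.sub
        (Lp.aestronglyMeasurable (gradDot ψ)))
      ((continuous_gradient (hη n)).aestronglyMeasurable.sub
        (Lp.aestronglyMeasurable (gradDot χ))) Fact.out)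
    filter_upwards [Lp.coeFn_add (gradDot ψ) (gradDot χ)] with x hx
    rw [map_add, hx, gradient_fun_add ((hφ n).differentiable (by simp) x)
      ((hη n).differentiable (by simp) x)]
    simp only [Pi.add_apply]
    abel
  · refine tendsto_of_tendsto_of_tendsto_of_le_of_le tendsto_const_nhds
      (by simpa using h3.add k3) (fun _ => zero_le) fun n => ?_
    refine le_trans (le_of_eq (eLpNorm_congr_ae ?_)) (eLpNorm_add_le
      ((hφc n _).sub (Lp.aestronglyMeasurable g))
      ((hηc n _).sub (Lp.aestronglyMeasurable h)) Fact.out)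
    filter_upwards [Lp.coeFn_add g h] with x hx
    rw [hx]
    simp only [Pi.add_apply]
    ring

lemma IsTrace.smul {ψ : WDot Ω p} {g : Lp ℝ p (areaOn Ω)} (c : ℝ) (hg : IsTrace ψ g) :
    IsTrace (c • ψ) (c • g) := by
  obtain ⟨φ, hφ, h1, h2, h3⟩ := hg
  have hlim : ∀ {s : ℕ → ℝ≥0∞}, Tendsto s atTop (𝓝 0) →
      Tendsto (fun n => ‖c‖ₑ * s n) atTop (𝓝 0) := fun hs => by
    simpa using ENNReal.Tendsto.const_mul hs (Or.inr (enorm_ne_top (x := c)))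
  refine ⟨fun n x => c * φ n x, fun n => contDiff_const.mul (hφ n), (hlim h1).congr fun n => ?_,
    (hlim h2).congr fun n => ?_, (hlim h3).congr fun n => ?_⟩
  · rw [← eLpNorm_const_smul]
    refine eLpNorm_congr_ae ?_
    filter_upwards [Lp.coeFn_smul c ψ.toLp] with x hx
    rw [map_smul, hx]
    simp [mul_sub]
  · rw [← eLpNorm_const_smul]
    refine eLpNorm_congr_ae ?_
    filter_upwards [Lp.coeFn_smul c (gradDot ψ)] with x hx
    rw [map_smul, hx, gradient_const_mul c ((hφ n).differentiable (by simp) x)]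
    simp [smul_sub]
  · rw [← eLpNorm_const_smul]
    refine eLpNorm_congr_ae ?_
    filter_upwards [Lp.coeFn_smul c g] with x hx
    rw [hx]
    simp [mul_sub]

/-- The trace inequality on `Ẇ^{1,p}(Ω)`. -/
lemma IsLipschitzDomain.exists_isTrace_bound (hΩ : IsLipschitzDomain Ω) (hp : p ≠ ⊤) :
    ∃ C : ℝ≥0, ∀ (ψ : WDot Ω p) (g : Lp ℝ p (areaOn Ω)), IsTrace ψ g →
      ‖g‖ₑ ≤ C * (‖ψ.toLp‖ₑ + ‖gradDot ψ‖ₑ) := by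
  obtain ⟨C, hC⟩ := hΩ.exists_trace_bound hp
  refine ⟨C, fun ψ g ⟨φ, hφ, h1, h2, h3⟩ => ?_⟩
  have hlim : Tendsto (fun n => eLpNorm (fun x => φ n x - g x) p (areaOn Ω) +
      C * ((eLpNorm (fun x => φ n x - ψ.toLp x) p (volOn Ω) + ‖ψ.toLp‖ₑ) +
        (eLpNorm (fun x => gradient (φ n) x - gradDot ψ x) p (volOn Ω) + ‖gradDot ψ‖ₑ))) atTop
      (𝓝 (0 + C * ((0 + ‖ψ.toLp‖ₑ) + (0 + ‖gradDot ψ‖ₑ)))) :=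
    h3.add (ENNReal.Tendsto.const_mul ((h1.add_const _).add (h2.add_const _))
      (Or.inr ENNReal.coe_ne_top))
  simp only [zero_add] at hlim
  refine ge_of_tendsto' hlim fun n => ?_
  have hφc := (hφ n).continuous
  rw [Lp.enorm_def, Lp.enorm_def, Lp.enorm_def]
  refine (eLpNorm_le_sub_add (Lp.aestronglyMeasurable g)
    (hφc.aestronglyMeasurable)).trans ?_
  rw [eLpNorm_fun_sub_comm]
  gcongr
  refine (hC _ (hφ n)).trans ?_
  rw [eLpNorm_fderiv_eq]
  gcongr
  · exact eLpNorm_le_sub_add hφc.aestronglyMeasurable (Lp.aestronglyMeasurable _)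
  · exact eLpNorm_le_sub_add (continuous_gradient (hφ n)).aestronglyMeasurable
      (Lp.aestronglyMeasurable _)

/-- By linearity `g - h` is a trace of `0`, and the trace inequality makes it vanish. -/
lemma IsLipschitzDomain.isTrace_unique (hΩ : IsLipschitzDomain Ω) (hp : p ≠ ⊤) {ψ : WDot Ω p}
    {g h : Lp ℝ p (areaOn Ω)} (hg : IsTrace ψ g) (hh : IsTrace ψ h) : g = h := by
  obtain ⟨C, hC⟩ := hΩ.exists_isTrace_bound hp
  have h0 := hC _ _ (hg.add (hh.smul (-1)))
  rw [neg_one_smul, neg_one_smul, add_neg_cancel, map_zero, map_zero, enorm_zero, enorm_zero,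
    add_zero, mul_zero, nonpos_iff_eq_zero, enorm_eq_zero] at h0
  rwa [add_neg_eq_zero] at h0

lemma isWeakGradient_toLp (ψ : WDot Ω p) : IsWeakGradient Ω ψ.toLp (gradDot ψ) := ψ.2.1

lemma IsLipschitzDomain.exists_smooth_approx_toLp (hΩ : IsLipschitzDomain Ω) (hp : p ≠ ⊤)
    (ψ : WDot Ω p) : ∃ φ : ℕ → E3 → ℝ, (∀ n, ContDiff ℝ ∞ (φ n)) ∧
      Tendsto (fun n => eLpNorm (fun x => φ n x - ψ.toLp x) p (volOn Ω)) atTop (𝓝 0) ∧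
      Tendsto (fun n => eLpNorm (fun x => gradient (φ n) x - gradDot ψ x) p (volOn Ω))
        atTop (𝓝 0) :=
  hΩ.exists_smooth_approx hp (Lp.stronglyMeasurable _) (Lp.stronglyMeasurable _) (Lp.memLp _)
    (Lp.memLp _) (isWeakGradient_toLp ψ)

/-- The trace inequality applied to `φ m - φ n` makes the boundary values of smooth approximants a
Cauchy sequence in `L^p(∂Ω)`. -/
lemma IsLipschitzDomain.exists_isTrace (hΩ : IsLipschitzDomain Ω) (hp : p ≠ ⊤)
    (ψ : WDot Ω p) : ∃ g : Lp ℝ p (areaOn Ω), IsTrace ψ g := by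
  obtain ⟨φ, hφ, h1, h2⟩ := hΩ.exists_smooth_approx_toLp hp ψ
  obtain ⟨C, hC⟩ := hΩ.exists_trace_bound (p := p) hp
  have hmem : ∀ n, MemLp (φ n) p (areaOn Ω) := fun n =>
    ⟨(hφ n).continuous.aestronglyMeasurable, (hC _ (hφ n)).trans_lt (by
      rw [eLpNorm_fderiv_eq]
      exact ENNReal.mul_lt_top ENNReal.coe_lt_top (ENNReal.add_lt_top.2
        ⟨(memLp_volOn_of_continuous hΩ (hφ n).continuous).2,
          (memLp_volOn_of_continuous hΩ (continuous_gradient (hφ n))).2⟩))⟩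
  set b : ℕ → ℝ≥0∞ := fun n => C * (eLpNorm (fun x => φ n x - ψ.toLp x) p (volOn Ω) +
    eLpNorm (fun x => gradient (φ n) x - gradDot ψ x) p (volOn Ω)) with hb
  have hb0 : Tendsto b atTop (𝓝 0) := by
    simpa using ENNReal.Tendsto.const_mul (h1.add h2) (Or.inr (ENNReal.coe_ne_top (r := C)))
  have hdist : ∀ m n, edist ((hmem m).toLp (φ m)) ((hmem n).toLp (φ n)) ≤ b m + b n := by
    intro m n
    rw [Lp.edist_toLp_toLp]
    refine (hC _ ((hφ m).sub (hφ n))).trans ?_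
    rw [eLpNorm_fderiv_eq, hb, ← mul_add]
    have e : gradient (fun x => φ m x - φ n x) = fun x => gradient (φ m) x - gradient (φ n) x := by
      ext1 x
      exact gradient_fun_sub ((hφ m).differentiable (by simp) x) ((hφ n).differentiable (by simp) x)
    rw [e, add_add_add_comm]
    gcongr
    · exact eLpNorm_sub_le_sub_add (hφ m).continuous.aestronglyMeasurable
        (Lp.aestronglyMeasurable _) (hφ n).continuous.aestronglyMeasurable
    · exact eLpNorm_sub_le_sub_add (continuous_gradient (hφ m)).aestronglyMeasurable
        (Lp.aestronglyMeasurable _) (continuous_gradient (hφ n)).aestronglyMeasurable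
  have hcau : CauchySeq fun n => (hmem n).toLp (φ n) := by
    rw [EMetric.cauchySeq_iff]
    intro ε hε
    obtain ⟨N, hN⟩ := eventually_atTop.1 (hb0.eventually_lt_const (ENNReal.half_pos hε.ne'))
    refine ⟨N, fun m hm n hn => (hdist m n).trans_lt ?_⟩
    have := ENNReal.add_lt_add (hN m hm) (hN n hn)
    rwa [ENNReal.add_halves] at this
  obtain ⟨g, hg⟩ := cauchySeq_tendsto_of_complete hcau
  refine ⟨g, φ, hφ, h1, h2, ?_⟩
  rw [Lp.tendsto_Lp_iff_tendsto_eLpNorm'] at hg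
  refine hg.congr fun n => eLpNorm_congr_ae ?_
  filter_upwards [(hmem n).coeFn_toLp] with x hx
  rw [Pi.sub_apply, hx]

lemma integral_toLp (ψ : WDot Ω p) : ∫ x in Ω, ψ.toLp x = 0 := ψ.2.2.2

/-- The Poincaré inequality on `Ẇ^{1,p}(Ω)`. -/
lemma IsLipschitzDomain.exists_poincare (hΩ : IsLipschitzDomain Ω) (hp : p ≠ ⊤) :
    ∃ C : ℝ≥0, ∀ ψ : WDot Ω p, ‖ψ.toLp‖ₑ ≤ C * ‖gradDot ψ‖ₑ := by
  have hfin := hΩ.isFiniteMeasure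
  have hp0 : p ≠ 0 := (lt_of_lt_of_le zero_lt_one Fact.out).ne'
  have hp1 : (1 : ℝ≥0∞) ≤ p := Fact.out
  obtain ⟨C, hC⟩ := hΩ.isPoincareSet (p := p) hp
  set m := volOn Ω univ with hm
  have hmt : m ≠ ⊤ := measure_ne_top _ _
  have hm0 : m ≠ 0 := by
    rw [hm, Measure.restrict_apply_univ]
    exact (hΩ.isOpen.measure_pos volume hΩ.isConnected.nonempty).ne'
  -- The Hölder factor for the embedding of `L^p` into `L^1`.
  set s : ℝ≥0∞ := m ^ (1 - 1 / p.toReal)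
  have hst : s ≠ ⊤ := by
    have : (1 : ℝ) / p.toReal ≤ 1 := by
      rw [div_le_one (by linarith [one_le_toReal hp])]
      exact one_le_toReal hp
    exact ENNReal.rpow_ne_top_of_nonneg (by linarith) hmt
  set K : ℝ≥0∞ := 1 + s / m * m ^ (1 / p.toReal)
  have hK : K ≠ ⊤ := ENNReal.add_ne_top.2 ⟨ENNReal.one_ne_top,
    ENNReal.mul_ne_top (ENNReal.div_ne_top hst hm0)
      (ENNReal.rpow_ne_top_of_nonneg (by positivity) hmt)⟩
  refine ⟨K.toNNReal * C, fun ψ => ?_⟩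
  rw [ENNReal.coe_mul, ENNReal.coe_toNNReal hK]
  obtain ⟨φ, hφ, h1, h2⟩ := hΩ.exists_smooth_approx_toLp hp ψ
  have hint : Integrable ψ.toLp (volOn Ω) := (Lp.memLp ψ.toLp).integrable hp1
  -- The mean of `ψ` is zero, so the integral of `ψ - c` is `-m c`, and `|c|` is controlled by `ψ -
  -- c` itself. Hence the unknown Poincaré constant `c` can be replaced by `0` at the cost of the
  -- factor `K`.
  have hsub : ∀ c : ℝ, ‖ψ.toLp‖ₑ ≤ K * eLpNorm (fun x => ψ.toLp x - c) p (volOn Ω) := by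
    intro c
    have hmeas : AEStronglyMeasurable (fun x => ψ.toLp x - c) (volOn Ω) :=
      (Lp.aestronglyMeasurable _).sub aestronglyMeasurable_const
    have e1 : ∫ x in Ω, (ψ.toLp x - c) = - (m.toReal * c) := by
      rw [integral_sub hint (integrable_const c), integral_toLp, integral_const]
      simp [hm, measureReal_def]
    have e2 : m * ‖c‖ₑ ≤ eLpNorm (fun x => ψ.toLp x - c) p (volOn Ω) * s := by
      have h3 := enorm_integral_le_lintegral_enorm (μ := volOn Ω) fun x => ψ.toLp x - c
      rw [e1, enorm_neg, enorm_mul, Real.enorm_of_nonneg ENNReal.toReal_nonneg,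
        ENNReal.ofReal_toReal hmt, ← eLpNorm_one_eq_lintegral_enorm] at h3
      refine h3.trans ((eLpNorm_le_eLpNorm_mul_rpow_measure_univ hp1 hmeas).trans_eq ?_)
      simp [s, hm]
    have e3 : ‖c‖ₑ ≤ s / m * eLpNorm (fun x => ψ.toLp x - c) p (volOn Ω) := by
      rw [mul_comm, ← mul_div_assoc, ENNReal.le_div_iff_mul_le (Or.inl hm0) (Or.inl hmt), mul_comm]
      exact e2
    rw [Lp.enorm_def]
    refine (eLpNorm_le_sub_add (g := fun _ => c) (Lp.aestronglyMeasurable _)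
      aestronglyMeasurable_const).trans ?_
    rw [eLpNorm_const' _ hp0 hp, add_mul, one_mul]
    refine add_le_add le_rfl ?_
    rw [mul_right_comm]
    exact mul_le_mul_left e3 _
  have hlim : Tendsto (fun n => K * (eLpNorm (fun x => φ n x - ψ.toLp x) p (volOn Ω) +
      C * (eLpNorm (fun x => gradient (φ n) x - gradDot ψ x) p (volOn Ω) + ‖gradDot ψ‖ₑ))) atTop
      (𝓝 (K * (0 + C * (0 + ‖gradDot ψ‖ₑ)))) :=
    ENNReal.Tendsto.const_mul (h1.add (ENNReal.Tendsto.const_mul (h2.add_const _)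
      (Or.inr ENNReal.coe_ne_top))) (Or.inr hK)
  rw [zero_add, zero_add, ← mul_assoc] at hlim
  refine ge_of_tendsto' hlim fun n => ?_
  obtain ⟨c, hc⟩ := hC _ (hφ n)
  refine (hsub c).trans ?_
  have hφc := (hφ n).continuous
  gcongr
  have h3 := eLpNorm_add_le (p := p)
    ((Lp.aestronglyMeasurable ψ.toLp).sub hφc.aestronglyMeasurable)
    ((hφc.sub continuous_const).aestronglyMeasurable (μ := volOn Ω) (f := fun x => φ n x - c)) hp1
  have e4 : (fun x => ψ.toLp x - c) = (⇑ψ.toLp - φ n) + fun x => φ n x - c := by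
    ext x; simp
  rw [e4]
  refine h3.trans (add_le_add ?_ (hc.trans ?_))
  · exact (eLpNorm_fun_sub_comm (fun x => ψ.toLp x) (φ n)).le
  · rw [eLpNorm_fderiv_eq]
    gcongr
    rw [Lp.enorm_def]
    exact eLpNorm_le_sub_add (continuous_gradient (hφ n)).aestronglyMeasurable
      (Lp.aestronglyMeasurable _)

/-- Uniqueness of traces makes a choice of traces linear. Poincaré removes `‖ψ‖_{L^p}` from the
trace bound, leaving the gradient norm only. -/
theorem IsLipschitzDomain.exists_isDelta (hΩ : IsLipschitzDomain Ω) (hp : p ≠ ⊤) :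
    ∃ δ : WDot Ω p →L[ℝ] Lp ℝ p (volOn Ω) × Lp ℝ p (areaOn Ω), IsDelta δ := by
  choose γ hγ using hΩ.exists_isTrace (p := p) hp
  obtain ⟨C, hC⟩ := hΩ.exists_isTrace_bound (p := p) hp
  obtain ⟨D, hD⟩ := hΩ.exists_poincare (p := p) hp
  let γl : WDot Ω p →ₗ[ℝ] Lp ℝ p (areaOn Ω) :=
    { toFun := γ
      map_add' := fun ψ χ => hΩ.isTrace_unique hp (hγ _) ((hγ ψ).add (hγ χ))
      map_smul' := fun c ψ => hΩ.isTrace_unique hp (hγ _) ((hγ ψ).smul c) }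
  have hbt : ∀ ψ : WDot Ω p, ‖ψ.toLp‖ ≤ D * ‖ψ‖ := by
    intro ψ
    have := hD ψ
    rw [← norm_gradDot]
    simp only [enorm_eq_nnnorm] at this
    exact_mod_cast this
  have hbg : ∀ ψ : WDot Ω p, ‖γ ψ‖ ≤ (C * (D + 1)) * ‖ψ‖ := by
    intro ψ
    have h1 := hC ψ _ (hγ ψ)
    simp only [enorm_eq_nnnorm] at h1
    have h2 : ‖γ ψ‖ ≤ C * (‖ψ.toLp‖ + ‖gradDot ψ‖) := by exact_mod_cast h1
    rw [norm_gradDot] at h2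
    have := mul_le_mul_of_nonneg_left (hbt ψ) C.2
    change (C : ℝ) * _ ≤ C * _ at this
    linarith
  -- The product carries the maximum norm, hence the maximum of the two constants.
  refine ⟨(WDot.toLp.prod γl).mkContinuous (max D (C * (D + 1))) fun ψ => ?_, fun ψ =>
    ⟨rfl, fun g => ⟨fun h => hΩ.isTrace_unique hp h (hγ ψ), ?_⟩⟩⟩
  · refine max_le ((hbt ψ).trans ?_) ((hbg ψ).trans ?_)
    · gcongr
      exact le_max_left _ _
    · gcongr
      exact le_max_right _ _
  · rintro rfl
    exact hγ ψ

/-- Integration by parts over the whole space; the test function and its derivative vanish outside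
`Ω`. -/
lemma isWeakGradient_of_contDiff {u : E3 → ℝ} (hu : ContDiff ℝ ∞ u) :
    IsWeakGradient Ω u (gradient u) := by
  intro φ hφ hc hs i
  set v : E3 := EuclideanSpace.single i 1
  have hdu : Continuous fun x => fderiv ℝ u x v :=
    (hu.continuous_fderiv (by simp)).clm_apply continuous_const
  obtain ⟨hd, hdc⟩ := test_fderiv hφ hc v
  have h := integral_mul_fderiv_eq_neg_fderiv_mul_of_integrable (μ := volume) (f := u) (g := φ)
    (v := v) ((hdu.mul hφ.continuous).integrable_of_hasCompactSupport hc.mul_left)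
    ((hu.continuous.mul hd).integrable_of_hasCompactSupport hdc.mul_left)
    ((hu.continuous.mul hφ.continuous).integrable_of_hasCompactSupport hc.mul_left)
    (fun x _ => hu.differentiable (by simp) x) fun x _ => hφ.differentiable (by simp) x
  have hφ0 : ∀ x ∉ Ω, φ x = 0 := fun x hx => image_eq_zero_of_notMem_tsupport fun h => hx (hs h)
  have hdφ0 : ∀ x ∉ Ω, fderiv ℝ φ x v = 0 := fun x hx => by
    rw [image_eq_zero_of_notMem_tsupport fun h => hx (hs (tsupport_fderiv_subset ℝ h))]
    rfl
  rw [setIntegral_eq_integral_of_forall_compl_eq_zero fun x hx => by rw [hdφ0 x hx, mul_zero],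
    setIntegral_eq_integral_of_forall_compl_eq_zero fun x hx => by rw [hφ0 x hx, mul_zero], h]
  simp only [gradient_coord]
  rfl

/-- The witness is a coordinate function minus its mean, whose gradient has a component identically
`1`. It makes the set of quotients in the supremum nonempty. -/
lemma IsLipschitzDomain.exists_ne_zero (hΩ : IsLipschitzDomain Ω) :
    ∃ ψ : WDot Ω p, ψ ≠ 0 := by
  have hfin := hΩ.isFiniteMeasure
  have hm0 : volOn Ω ≠ 0 := by
    intro h0
    have := (hΩ.isOpen.measure_pos volume hΩ.isConnected.nonempty).ne'
    exact this (Measure.restrict_eq_zero.1 h0)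
  set f : E3 → ℝ := fun x => x 0
  have hf : ContDiff ℝ ∞ f := (EuclideanSpace.proj (𝕜 := ℝ) (0 : Fin 3)).contDiff
  set c : ℝ := ⨍ x in Ω, f x
  set u : E3 → ℝ := fun x => f x - c
  have hu : ContDiff ℝ ∞ u := hf.sub contDiff_const
  have hum : MemLp u p (volOn Ω) := memLp_volOn_of_continuous hΩ hu.continuous
  have hGm : MemLp (gradient u) p (volOn Ω) :=
    memLp_volOn_of_continuous hΩ (continuous_gradient hu)
  have hg : ∀ x, gradient u x 0 = 1 := by
    intro x
    rw [gradient_coord]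
    have : fderiv ℝ u x = EuclideanSpace.proj (𝕜 := ℝ) (0 : Fin 3) :=
      ((EuclideanSpace.proj (𝕜 := ℝ) (0 : Fin 3)).hasFDerivAt.sub_const c).fderiv
    rw [this]
    simp
  have hfi : Integrable f (volOn Ω) :=
    memLp_one_iff_integrable.1 (memLp_volOn_of_continuous hΩ hf.continuous)
  have hui : Integrable u (volOn Ω) := hfi.sub (integrable_const c)
  have hmem : (hum.toLp u, hGm.toLp (gradient u)) ∈ zeroMeanSobolev Ω p := by
    refine ⟨fun φ hφ hc hs i => ?_, hui.congr hum.coeFn_toLp.symm, ?_⟩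
    · have h := isWeakGradient_of_contDiff hu φ hφ hc hs i
      refine (integral_congr_ae ?_).trans (h.trans (congrArg Neg.neg (integral_congr_ae ?_)))
      · filter_upwards [hum.coeFn_toLp] with x hx
        rw [hx]
      · filter_upwards [hGm.coeFn_toLp] with x hx
        rw [hx]
    · refine (integral_congr_ae hum.coeFn_toLp).trans ?_
      exact integral_sub_average (volOn Ω) f
  refine ⟨⟨_, hmem⟩, fun h0 => hm0 ?_⟩
  have h1 : hGm.toLp (gradient u) = 0 :=
    congrArg (fun ψ : zeroMeanSobolev Ω p => ψ.1.2) h0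
  have h2 : ∀ᵐ x ∂volOn Ω, False := by
    filter_upwards [hGm.coeFn_toLp, Lp.coeFn_zero E3 p (volOn Ω)] with x hx hx0
    rw [h1, hx0] at hx
    have := hg x
    rw [← hx] at this
    simp at this
  simpa using h2

end

end FluxOpt

end


theorem mainTheorem1 (Ω : Set FluxOpt.E3) (hΩ : FluxOpt.IsLipschitzDomain Ω)
    (p q : ℝ≥0∞) [Fact (1 ≤ p)] [Fact (1 ≤ q)] (hp : p ≠ ⊤) [ENNReal.HolderConjugate p q] :
    ∃ δ : FluxOpt.WDot Ω p →L[ℝ] Lp ℝ p (FluxOpt.volOn Ω) × Lp ℝ p (FluxOpt.areaOn Ω),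
      FluxOpt.IsDelta δ ∧
      ∀ (β : Lp ℝ q (FluxOpt.volOn Ω)) (τ : Lp ℝ q (FluxOpt.areaOn Ω)),
        ∃ wopt : Lp FluxOpt.E3 q (FluxOpt.volOn Ω),
          FluxOpt.deltaDual δ β τ = FluxOpt.gradDual wopt ∧
          sInf {c : ℝ | ∃ w : Lp FluxOpt.E3 q (FluxOpt.volOn Ω),
            FluxOpt.deltaDual δ β τ = FluxOpt.gradDual w ∧ c = ‖w‖} = ‖wopt‖ ∧
          ‖wopt‖ = ‖FluxOpt.deltaDual δ β τ‖ ∧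
          IsLUB {c : ℝ | ∃ ψ : FluxOpt.WDot Ω p, ψ ≠ 0 ∧
            c = ((∫ x in Ω, β x * ψ.toLp x) + ∫ x, τ x * (δ ψ).2 x ∂(FluxOpt.areaOn Ω)) /
              (∫ x in Ω, ‖FluxOpt.gradDot ψ x‖ ^ p.toReal) ^ (1 / p.toReal)} ‖wopt‖ := by
  obtain ⟨δ, hδ⟩ := hΩ.exists_isDelta hp
  have := hΩ.isFiniteMeasure
  refine ⟨δ, hδ, fun β τ => ?_⟩
  obtain ⟨w, h1, h2, h3⟩ := FluxOpt.exists_optimal_flux (q := q) hp (FluxOpt.deltaDual δ β τ)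
  refine ⟨w, h1, h2, h3, ?_⟩
  rw [h3]
  have h4 := FluxOpt.isLUB_ratio (FluxOpt.deltaDual δ β τ) hΩ.exists_ne_zero
  simpa only [FluxOpt.deltaDual_apply δ (fun ψ => (hδ ψ).1), FluxOpt.norm_eq_integral_rpow hp]
    using h4
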